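/- **Notation.** All graphs are finite and simple. $K_m$, $I_m$, $P_m$ denote the complete graph, the edgeless graph and the path on $m$ vertices ($K_0$ is the graph without vertices), and $M_m$ is the matching consisting of $m$ independent edges. $G\cup H$ is the disjoint union, $kH$ the disjoint union of $k$ copies of $H$, and $G\vee H$ the join ($G\cup H$ together with all edges between $G$ and $H$). $\mathcal N(H,G)$ is the number of copies of $H$ in $G$ (subgraphs of $G$ isomorphic to $H$), and $\mathrm{ex}(n,H,\mathcal F)$ is the maximum of $\mathcal N(H,G)$ over all $n$-vertex graphs $G$ that contain no member of $\mathcal F$ as a subgraph. **Theorem.** Let $r\ge 2$ and $2\le p\le s$ be integers with $r\le p$ or $r>2p$ (in the latter case all the numbers below are $0$). Write $s-p+1=cp+d$ with integers $c\ge 0$ and $0\le d\le p-1$, and put $q=\left\lfloor\frac{s-p+1}{p-1}\right\rfloor$ and $t=s-(q+1)(p-1)$. For an integer $j\ge 0$ let $e(j)=0$ if $j=0$ and $e(j)=2j+1$ if $j\neq 0$. Define the following graphs on $n$ vertices: - $G_3=(K_{p-1}\vee I_{n-(p-1)-q(2p-1)-e(t)})\cup qK_{2p-1}\cup K_{e(t)}$;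 - $G_4=(K_{p-1}\vee I_{n-(p-1)-2cp-e(d)})\cup cK_{2p}\cup K_{e(d)}$; - if $1\le d\le p-2$ and $c+d+1\ge p$, $G_5=(K_{p-1}\vee I_{n-(p-1)-2p(c+d+1-p)-(p-d)(2p-1)})\cup(c+d+1-p)K_{2p}\cup(p-d)K_{2p-1}$; - if $1\le d\le p-1$, $G_6=(K_{p-1}\vee(K_2\cup I_{n-p-1-2cp}))\cup cK_{2p}$. Then for all $n\ge n_0(r,p,s)$: - if $d=0$, then $\mathrm{ex}(n,K_r,\{P_{2p+1},M_{s+1}\})=\max\{\mathcal N(K_r,G_3),\mathcal N(K_r,G_4)\}$; - if $1\le d\le p-2$, then $\mathrm{ex}(n,K_r,\{P_{2p+1},M_{s+1}\})=\max\{\mathcal N(K_r,G_3),\mathcal N(K_r,G_4),\mathcal N(K_r,G_5),\mathcal N(K_r,G_6)\}$, where the term $\mathcal N(K_r,G_5)$ is omitted if $c+d+1<p$; - if $d=p-1$, then $\mathrm{ex}(n,K_r,\{P_{2p+1},M_{s+1}\})=\max\{\mathcal N(K_r,G_3),\mathcal N(K_r,G_4),\mathcal N(K_r,G_6)\}$.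 -/

import Mathlib

namespace BoundedMatching

open SimpleGraph

/-- The join `G ∨ H`: the disjoint union of `G` and `H` together with all edges between them. -/
def join {V W : Type*} (G : SimpleGraph V) (H : SimpleGraph W) : SimpleGraph (V ⊕ W) where
  Adj
    | Sum.inl u, Sum.inl v => G.Adj u v
    | Sum.inr u, Sum.inr v => H.Adj u v
    | Sum.inl _, Sum.inr _ => True
    | Sum.inr _, Sum.inl _ => True
  symm := ⟨by
    rintro (u | u) (v | v) h
    · exact G.adj_symm h
    · trivial
    · trivial
    · exact H.adj_symm h⟩
  loopless := ⟨by
    rintro (u | u) h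
    · exact G.loopless.irrefl u h
    · exact H.loopless.irrefl u h⟩

/-- The disjoint union `k H` of `k` copies of `H`. -/
def copies {W : Type*} (k : ℕ) (H : SimpleGraph W) : SimpleGraph (Fin k × W) where
  Adj x y := x.1 = y.1 ∧ H.Adj x.2 y.2
  symm := ⟨fun _ _ h => ⟨h.1.symm, h.2.symm⟩⟩
  loopless := ⟨fun x h => H.loopless.irrefl x.2 h.2⟩

/-- The complete graph `K_m`. -/
abbrev K (m : ℕ) : SimpleGraph (Fin m) := ⊤

/-- The edgeless graph `I_m`. -/
abbrev I (m : ℕ) : SimpleGraph (Fin m) := ⊥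

/-- The matching `M_m`, consisting of `m` independent edges. -/
abbrev matching (m : ℕ) : SimpleGraph (Fin m × Fin 2) := copies m (K 2)

open scoped Classical in
/-- The generalized Turán number `ex(n, H, 𝓕)`: the maximum of `𝒩(H, G)`, the number of
(unlabelled) copies of `H` in `G`, over the `n`-vertex graphs `G` that contain no member of `𝓕`
as a subgraph. (It is `0` if there is no such `G`.) -/
noncomputable def ex {W : Type*} (n : ℕ) (H : SimpleGraph W) (𝓕 : Set (Σ V : Type, SimpleGraph V)) :
    ℕ :=
  Finset.sup (Finset.univ.filter fun G : SimpleGraph (Fin n) => ∀ F ∈ 𝓕, F.2.Free G)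
    fun G => G.copyCount H

/-- The number of vertices of the last clique of `G₃` and `G₄`: there is no such clique if the
remainder `t` is `0`, and it has `2 t + 1` vertices otherwise. -/
def lastOrder (t : ℕ) : ℕ := if t = 0 then 0 else 2 * t + 1

/-- `(K_{p-1} ∨ I_m) ∪ q K_{2p-1} ∪ K_e`, where `q = ⌊(s-p+1)/(p-1)⌋`, `t = s - (q+1)(p-1)`,
`e = 0` if `t = 0` and `e = 2t+1` if `t ≠ 0`, and `m` makes the total number of vertices `n`. -/
abbrev G₃ (n s p : ℕ) :=
  let q := (s - p + 1) / (p - 1)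
  let e := lastOrder (s - (q + 1) * (p - 1))
  join (K (p - 1)) (I (n - ((p - 1) + q * (2 * p - 1) + e))) ⊕g copies q (K (2 * p - 1)) ⊕g K e

/-- `(K_{p-1} ∨ I_m) ∪ c K_{2p} ∪ K_e`, where `e = 0` if `d = 0` and `e = 2d+1` if `d ≠ 0`, and `m`
makes the total number of vertices `n`. -/
abbrev G₄ (n p c d : ℕ) :=
  let e := lastOrder d
  join (K (p - 1)) (I (n - ((p - 1) + c * (2 * p) + e))) ⊕g copies c (K (2 * p)) ⊕g K e

/-- `(K_{p-1} ∨ I_m) ∪ (c+d+1-p) K_{2p} ∪ (p-d) K_{2p-1}`, where `m` makes the total number of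
vertices `n`. It is meant for `d ≤ p ≤ c + d + 1` only. -/
abbrev G₅ (n p c d : ℕ) :=
  join (K (p - 1)) (I (n - ((p - 1) + (c + d + 1 - p) * (2 * p) + (p - d) * (2 * p - 1))))
    ⊕g copies (c + d + 1 - p) (K (2 * p)) ⊕g copies (p - d) (K (2 * p - 1))

/-- `(K_{p-1} ∨ (K_2 ∪ I_m)) ∪ c K_{2p}`, where `m` makes the total number of vertices `n`. -/
abbrev G₆ (n p c : ℕ) :=
  join (K (p - 1)) (K 2 ⊕g I (n - ((p - 1) + 2 + c * (2 * p)))) ⊕g copies c (K (2 * p))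

end BoundedMatching

namespace BoundedMatching

/-- The contribution of a component `K_m` to the number of copies of `K_{k+2}`, compared with `m`
further vertices joined to a clique `K_P`. -/
def gain (P k m : ℕ) : ℤ := (m.choose (k + 2) : ℤ) - m * (P.choose (k + 1) : ℤ)

/-- Abstract properties of the gains: `w j` is the gain of the clique with matching number `j`,
`A` the gain of `K_{2P+2}` and `E` the gain of an edge inside the independent part. -/
structure GainSystem (P : ℕ) (A E : ℤ) (w : ℕ → ℤ) : Prop where
  zero : w 0 = 0
  convex : ∀ j, w (j + 1) - w j ≤ w (j + 2) - w (j + 1)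
  edge_nonneg : 0 ≤ E
  edge_le : E ≤ A
  edge_le_sub : E ≤ A - w P
  ratio : (P + 1) * w P ≤ P * A
  step : ∀ j, 0 < w j → E ≤ w (j + 1) - w j

/-- `M` is at least each of the four values given by the constructions. -/
structure Dominates (P c d : ℕ) (A E : ℤ) (w : ℕ → ℤ) (M : ℤ) : Prop where
  three : (((c * (P + 1) + d) / P : ℕ) : ℤ) * w P + w ((c * (P + 1) + d) % P) ≤ M
  four : c * A + w d ≤ M
  five : 1 ≤ d → d + 1 ≤ P → P ≤ c + d →
    ((c + d - P : ℕ) : ℤ) * A + ((P + 1 - d : ℕ) : ℤ) * w P ≤ M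
  six : 1 ≤ d → c * A + E ≤ M

namespace GainSystem

variable {P : ℕ} {A E : ℤ} {w : ℕ → ℤ}

lemma mono_step (h : GainSystem P A E w) {i j : ℕ} (hij : i ≤ j) :
    w (i + 1) - w i ≤ w (j + 1) - w j := by
  induction j, hij using Nat.le_induction with
  | base => exact le_rfl
  | succ j _ ih => exact ih.trans (h.convex j)

lemma exchange (h : GainSystem P A E w) {i j : ℕ} (hij : i ≤ j) (t : ℕ) :
    w (i + t) + w j ≤ w i + w (j + t) := by
  induction t with
  | zero => simp
  | succ t ih =>
    have := h.mono_step (show i + t ≤ j + t by omega)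
    rw [← add_assoc, ← add_assoc]
    linarith

lemma merge (h : GainSystem P A E w) {i j : ℕ} (hi : i ≤ P) (hj : j ≤ P) :
    w i + w j ≤ w (i + j) ∧ (P ≤ i + j → w i + w j ≤ w P + w (i + j - P)) := by
  wlog hij : i ≤ j generalizing i j
  · have := this hj hi (by omega)
    rw [add_comm (w i), add_comm i]
    exact this
  constructor
  · have := h.exchange (Nat.zero_le j) i
    rw [h.zero, zero_add, zero_add, add_comm j i] at this
    exact this
  · intro hP
    have := h.exchange (show i + j - P ≤ j by omega) (P - j)
    rw [show i + j - P + (P - j) = i by omega, show j + (P - j) = P by omega] at this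
    linarith

variable {c d : ℕ} {M : ℤ}

lemma tight_zero (h : GainSystem P A E w) (hM : Dominates P c d A E w M) (hd : d ≤ P) (a b : ℕ)
    (hab : a * (P + 1) + b * P = c * (P + 1) + d) : a * A + b * w P ≤ M := by
  induction b using Nat.strong_induction_on generalizing a with
  | _ b ih =>
    by_cases hb : P + 1 ≤ b
    · obtain ⟨b, rfl⟩ := Nat.exists_eq_add_of_le hb
      have := ih b (by omega) (a + P) (by rw [← hab]; ring)
      have h3 := h.ratio
      push_cast at this ⊢
      linarith
    · have key : (a + b) * (P + 1) = c * (P + 1) + (d + b) := by linarith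
      rcases Nat.eq_zero_or_pos b with rfl | hb0
      · have hac : a = c := by
          have h1 : (a * (P + 1) + 0) / (P + 1) = (c * (P + 1) + d) / (P + 1) := by
            simp at hab; simp [hab]
          rw [Nat.mul_comm, Nat.mul_add_div (by omega), Nat.mul_comm,
            Nat.mul_add_div (by omega), Nat.div_eq_of_lt (show d < P + 1 by omega)] at h1
          simpa using h1
        subst hac
        have hd0 : d = 0 := by simpa using hab
        subst hd0
        have := hM.four
        rw [h.zero] at this
        simpa using this
      · have hdb : d + b = P + 1 ∧ a + b = c + 1 := by
          have hdvd : d + b = (a + b - c) * (P + 1) := by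
            rw [Nat.sub_mul, key]; omega
          have h1 : a + b - c = 1 := by
            rcases Nat.lt_trichotomy (a + b - c) 1 with h' | h' | h'
            · rw [Nat.lt_one_iff.1 h'] at hdvd; omega
            · exact h'
            · have := Nat.mul_le_mul_right (P + 1) h'
              simp only [Nat.succ_eq_add_one] at this
              omega
          rw [h1] at hdvd
          omega
        by_cases hb1 : b = 1
        · subst hb1
          have h4 := hM.four
          rw [show d = P by omega, show c = a by omega] at h4
          simpa using h4
        · have h5 := hM.five (by omega) (by omega) (by omega)
          rwa [show c + d - P = a by omega, show P + 1 - d = b by omega] at h5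

lemma tight_up (h : GainSystem P A E w) (hM : Dominates P c d A E w M) (hd : d ≤ P) (a b j : ℕ)
    (hj : j ≤ P) (hab : a * (P + 1) + b * P + j = c * (P + 1) + d)
    (hup : A - w P ≤ w (j + 1) - w j) : a * A + b * w P + w j ≤ M := by
  rcases hj.lt_or_eq with hj | rfl
  · induction a generalizing b j with
    | zero =>
      have h3 := hM.three
      rw [← hab, zero_mul, zero_add, Nat.mul_comm, Nat.mul_add_div (by omega),
        Nat.div_eq_of_lt hj, Nat.mul_add_mod, Nat.mod_eq_of_lt hj] at h3
      simpa using h3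
    | succ a ih =>
      have hup' := hup.trans (h.convex j)
      have hab' : a * (P + 1) + (b + 1) * P + (j + 1) = c * (P + 1) + d := by rw [← hab]; ring
      have : a * A + (b + 1 : ℕ) * w P + w (j + 1) ≤ M := by
        rcases (Nat.succ_le_of_lt hj).lt_or_eq with hj' | hj'
        · exact ih _ _ (by omega) hab' hup' hj'
        · rw [Nat.succ_eq_add_one] at hj'
          have := h.tight_zero hM hd a (b + 2) (by rw [← hab', hj']; ring)
          rw [hj']
          push_cast at this ⊢
          linarith
      push_cast at this ⊢
      linarith
  · have := h.tight_zero hM hd a (b + 1) (by rw [← hab]; ring)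
    push_cast at this
    linarith

lemma tight_down (h : GainSystem P A E w) (hM : Dominates P c d A E w M) (hd : d ≤ P) (a b j : ℕ)
    (hj : j + 1 ≤ P) (hab : a * (P + 1) + b * P + (j + 1) = c * (P + 1) + d)
    (hdown : w (j + 1) - w j ≤ A - w P) : a * A + b * w P + w (j + 1) ≤ M := by
  induction j generalizing a b with
  | zero =>
    cases b with
    | zero =>
      have h1 : (a * (P + 1) + 1) / (P + 1) = (c * (P + 1) + d) / (P + 1) := by
        simp at hab; simp [hab]
      rw [Nat.mul_comm, Nat.mul_add_div (by omega), Nat.mul_comm,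
        Nat.mul_add_div (by omega), Nat.div_eq_of_lt (show d < P + 1 by omega),
        Nat.div_eq_of_lt (show 1 < P + 1 by omega)] at h1
      simp only [add_zero] at h1
      subst h1
      have hd0 : d = 1 := by simpa using hab.symm
      subst hd0
      simpa using hM.four
    | succ b =>
      have := h.tight_zero hM hd (a + 1) b (by rw [← hab]; ring)
      rw [h.zero] at hdown
      push_cast at this ⊢
      linarith
  | succ j ih =>
    cases b with
    | zero =>
      have h1 : (a * (P + 1) + (j + 2)) / (P + 1) = (c * (P + 1) + d) / (P + 1) := by
        rw [← hab]; congr 1; ring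
      rw [Nat.mul_comm, Nat.mul_add_div (by omega), Nat.mul_comm,
        Nat.mul_add_div (by omega), Nat.div_eq_of_lt (show d < P + 1 by omega),
        Nat.div_eq_of_lt (show j + 2 < P + 1 by omega)] at h1
      simp only [add_zero] at h1
      subst h1
      have hd0 : d = j + 1 + 1 := by simpa using hab.symm
      subst hd0
      simpa using hM.four
    | succ b =>
      have hc := h.convex j
      have := ih (a + 1) b (by omega) (by rw [← hab]; ring) (hc.trans hdown)
      push_cast at this ⊢
      linarith

lemma tight (h : GainSystem P A E w) (hM : Dominates P c d A E w M) (hd : d ≤ P) (a b j : ℕ)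
    (hj : j ≤ P) (hab : a * (P + 1) + b * P + j = c * (P + 1) + d) :
    a * A + b * w P + w j ≤ M := by
  cases j with
  | zero =>
    have := h.tight_zero hM hd a b (by simpa using hab)
    rw [h.zero]
    linarith
  | succ j =>
    rcases le_total (A - w P) (w (j + 1 + 1) - w (j + 1)) with h' | h'
    · exact h.tight_up hM hd a b (j + 1) hj hab h'
    · exact h.tight_down hM hd a b j hj hab ((h.convex j).trans h')

lemma edge_bound (h : GainSystem P A E w) (hM : Dominates P c d A E w M) (hd : d ≤ P) (a : ℕ)
    (hab : a * (P + 1) + 1 ≤ c * (P + 1) + d) : a * A + E ≤ M := by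
  have hA := h.edge_nonneg.trans h.edge_le
  rcases Nat.eq_zero_or_pos d with rfl | hd0
  · have hac : a + 1 ≤ c := by
      by_contra hcon
      have := Nat.mul_le_mul_right (P + 1) (show c ≤ a by omega)
      omega
    have h4 := hM.four
    rw [h.zero] at h4
    have : ((a + 1 : ℕ) : ℤ) * A ≤ c * A := mul_le_mul_of_nonneg_right (by exact_mod_cast hac) hA
    push_cast at this
    linarith [h.edge_le]
  · have hac : a ≤ c := by
      by_contra hcon
      have := Nat.mul_le_mul_right (P + 1) (show c + 1 ≤ a by omega)
      rw [Nat.add_mul] at this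
      omega
    have : (a : ℤ) * A ≤ c * A := mul_le_mul_of_nonneg_right (by exact_mod_cast hac) hA
    linarith [hM.six hd0]

lemma slack_bound (h : GainSystem P A E w) (hM : Dominates P c d A E w M) (hd : d ≤ P)
    (u a b j : ℕ) (hj : j ≤ P) (hab : a * (P + 1) + b * P + j + u = c * (P + 1) + d) :
    a * A + b * w P + w j + (if u = 0 then 0 else E) ≤ M := by
  have hE := h.edge_nonneg
  have hlast (u : ℕ) : (0 : ℤ) ≤ if u = 0 then 0 else E := by split_ifs <;> simp [hE]
  induction u generalizing a b j with
  | zero => simpa using h.tight hM hd a b j hj (by simpa using hab)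
  | succ u ih =>
    have hu := hlast u
    rw [if_neg (Nat.succ_ne_zero u)]
    cases b with
    | succ b =>
      have := ih (a + 1) b j hj (by rw [← hab]; ring)
      push_cast at this ⊢
      linarith [h.edge_le_sub]
    | zero =>
      by_cases hw : 0 < w j
      · rcases hj.lt_or_eq with hj | rfl
        · have := ih a 0 (j + 1) hj (by rw [← hab]; ring)
          linarith [h.step j hw]
        · have := ih (a + 1) 0 0 (by omega) (by rw [← hab]; ring)
          rw [h.zero] at this
          push_cast at this ⊢
          linarith [h.edge_le_sub]
      · have := h.edge_bound hM hd a (by omega)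
        push_cast
        linarith

lemma bound (h : GainSystem P A E w) (hM : Dominates P c d A E w M) (hd : d ≤ P)
    (a b j : ℕ) (hj : j ≤ P) (hab : a * (P + 1) + b * P + j ≤ c * (P + 1) + d) :
    a * A + b * w P + w j ≤ M := by
  obtain ⟨u, hu⟩ := Nat.exists_eq_add_of_le hab
  have := h.slack_bound hM hd u a b j hj hu.symm
  have hE := h.edge_nonneg
  split_ifs at this <;> linarith

lemma bound_edge (h : GainSystem P A E w) (hM : Dominates P c d A E w M) (hd : d ≤ P)
    (a b j : ℕ) (hj : j ≤ P) (hab : a * (P + 1) + b * P + j + 1 ≤ c * (P + 1) + d) :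
    a * A + b * w P + w j + E ≤ M := by
  obtain ⟨u, hu⟩ := Nat.exists_eq_add_of_le hab
  have := h.slack_bound hM hd (1 + u) a b j hj (by rw [hu]; ring)
  rwa [if_neg (by omega)] at this

end GainSystem

lemma choose_add_choose_ge (P k i : ℕ) (hi : i ≤ P) :
    P.choose (k + 1) + (P + 1).choose (k + 1) ≤
      (P - i).choose (k + 1) + (P + 1 + i).choose (k + 1) := by
  induction i with
  | zero => simp
  | succ i ih =>
    refine (ih (by omega)).trans ?_
    obtain ⟨m, hm⟩ : ∃ m, P - i = m + 1 := ⟨P - i - 1, by omega⟩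
    rw [show P - (i + 1) = m by omega, hm, ← add_assoc (P + 1), Nat.choose_succ_succ' m,
      Nat.choose_succ_succ' (P + 1 + i)]
    have := Nat.choose_le_choose k (show m ≤ P + 1 + i by omega)
    omega

lemma choose_sub_choose_ge (P k i : ℕ) (hi : i ≤ P + 1) :
    (P + 1 - i).choose (k + 2) + i * (P.choose (k + 1) + (P + 1).choose (k + 1)) ≤
      (P + 1 + i).choose (k + 2) := by
  induction i with
  | zero => simp
  | succ i ih =>
    have h1 := ih (by omega)
    have h2 := choose_add_choose_ge P k i (by omega)
    obtain ⟨m, hm⟩ : ∃ m, P + 1 - i = m + 1 := ⟨P - i, by omega⟩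
    rw [hm, Nat.choose_succ_succ' m] at h1
    rw [show P - i = m by omega] at h2
    rw [show P + 1 - (i + 1) = m by omega, ← add_assoc (P + 1), Nat.choose_succ_succ' (P + 1 + i),
      Nat.add_mul]
    simp only [Nat.reduceAdd, add_assoc] at *
    omega

lemma gain_succ (P k m : ℕ) :
    gain P k (m + 1) = gain P k m + m.choose (k + 1) - P.choose (k + 1) := by
  simp only [gain, Nat.choose_succ_succ' m]
  push_cast
  ring

lemma lastOrder_succ (j : ℕ) : lastOrder (j + 1) = 2 * j + 3 := by
  simp [lastOrder]; ring

lemma gain_lastOrder_step (P k j : ℕ) :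
    gain P k (lastOrder (j + 1)) - gain P k (lastOrder j) =
      (2 * j + 2).choose (k + 1) + (2 * j + 1).choose (k + 1) - 2 * P.choose (k + 1)
        - if j = 0 then (P.choose (k + 1) : ℤ) else 0 := by
  cases j with
  | zero =>
    have h3 := gain_succ P k 2
    have h2 := gain_succ P k 1
    have h1 : gain P k 1 = -P.choose (k + 1) := by
      simp [gain, Nat.choose_eq_zero_of_lt (show 1 < k + 2 by omega)]
    have h0 : gain P k 0 = 0 := by simp [gain]
    simp only [lastOrder, zero_add, one_ne_zero, if_false, if_true] at *
    norm_num at *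
    rw [h3, h2, h1, h0]
    ring
  | succ j =>
    rw [lastOrder_succ, lastOrder_succ, show 2 * (j + 1) + 3 = 2 * j + 3 + 1 + 1 by ring,
      gain_succ, gain_succ]
    rw [if_neg (Nat.succ_ne_zero j), show 2 * (j + 1) + 2 = 2 * j + 3 + 1 by ring,
      show 2 * (j + 1) + 1 = 2 * j + 3 by ring]
    ring

lemma choose_le_mul_choose (m k : ℕ) : (m + 1).choose (k + 1) ≤ (m + 1) * m.choose k := by
  rw [Nat.add_one_mul_choose_eq]
  exact Nat.le_mul_of_pos_right _ (by omega)

lemma gainSystem (P k : ℕ) (hP : 1 ≤ P) :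
    GainSystem P (gain P k (2 * P + 2)) (P.choose k) (fun j => gain P k (lastOrder j)) := by
  have hlast : lastOrder P = 2 * P + 1 := by simp [lastOrder]; omega
  have hpas : ((P + 1).choose (k + 1) : ℤ) = P.choose k + P.choose (k + 1) := by
    rw [Nat.choose_succ_succ']; push_cast; ring
  refine ⟨by simp [lastOrder, gain], fun j => ?_, by positivity, ?_, ?_, ?_, fun j hj => ?_⟩
  · simp only [show j + 2 = j + 1 + 1 from rfl, gain_lastOrder_step]
    rw [if_neg (Nat.succ_ne_zero j)]
    have h1 := Nat.choose_le_choose (k + 1) (show 2 * j + 2 ≤ 2 * (j + 1) + 2 by omega)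
    have h2 := Nat.choose_le_choose (k + 1) (show 2 * j + 1 ≤ 2 * (j + 1) + 1 by omega)
    have h3 : (0 : ℤ) ≤ if j = 0 then (P.choose (k + 1) : ℤ) else 0 := by positivity
    zify at h1 h2
    linarith
  · have h := choose_sub_choose_ge P k (P + 1) le_rfl
    rw [Nat.sub_self, show P + 1 + (P + 1) = 2 * P + 2 by ring] at h
    simp only [gain]
    zify at h
    rw [hpas] at h
    simp at h
    push_cast
    nlinarith [mul_nonneg (Int.natCast_nonneg P) (Int.natCast_nonneg (P.choose k))]
  · simp only [hlast]
    rw [show 2 * P + 2 = 2 * P + 1 + 1 by ring, gain_succ]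
    have h1 := Nat.choose_le_choose (k + 1) (show P + 1 ≤ 2 * P + 1 by omega)
    zify at h1
    linarith
  · simp only [hlast]
    have h1 : (2 * P + 1).choose (k + 2) ≤ P * (2 * P + 1).choose (k + 1) := by
      have h := Nat.choose_succ_right_eq (2 * P + 1) (k + 1)
      have h' : (2 * P + 1).choose (k + 2) * 2 ≤ (2 * P + 1).choose (k + 1) * (2 * P) := by
        calc _ ≤ (2 * P + 1).choose (k + 2) * (k + 2) := Nat.mul_le_mul_left _ (by omega)
          _ = _ := h
          _ ≤ _ := Nat.mul_le_mul_left _ (by omega)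
      nlinarith
    have h2 : (0 : ℤ) ≤ P.choose (k + 1) := by positivity
    have h3 := gain_succ P k (2 * P + 1)
    have h4 : gain P k (2 * P + 1) =
      ((2 * P + 1).choose (k + 2) : ℤ) - (2 * P + 1) * (P.choose (k + 1) : ℤ) := by
        simp [gain]
    rw [show 2 * P + 2 = 2 * P + 1 + 1 by ring, h3, h4]
    zify at h1
    nlinarith
  · simp only [gain_lastOrder_step]
    cases j with
    | zero => simp [lastOrder, gain] at hj
    | succ j =>
      have hPj : P ≤ 2 * j + 2 := by
        by_contra hcon
        rw [lastOrder_succ, gain] at hj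
        have h1 := choose_le_mul_choose (2 * j + 2) (k + 1)
        have h2 := Nat.choose_le_choose (k + 1) (show 2 * j + 2 ≤ P by omega)
        have h3 := h1.trans (Nat.mul_le_mul_left _ h2)
        rw [show 2 * j + 2 + 1 = 2 * j + 3 by ring] at h3
        zify at h3
        push_cast at hj
        linarith
      have h1 := Nat.choose_le_choose (k + 1) (show P + 1 ≤ 2 * (j + 1) + 2 by omega)
      have h2 := Nat.choose_le_choose (k + 1) (show P ≤ 2 * (j + 1) + 1 by omega)
      rw [if_neg (Nat.succ_ne_zero j)]
      zify at h1 h2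
      linarith

/-- A clique of order between `P + 2` and `2 P + 1` gains no more than the clique of odd order with
the same matching number. -/
lemma gain_le_gain_lastOrder {P k m : ℕ} (hm : P + 1 ≤ m) (h1 : 1 < m) :
    gain P k m ≤ gain P k (lastOrder (m / 2)) := by
  have hlast : lastOrder (m / 2) = 2 * (m / 2) + 1 := by
    simp [lastOrder]; omega
  rw [hlast]
  rcases Nat.even_or_odd' m with ⟨i, rfl | rfl⟩
  · rw [Nat.mul_div_cancel_left _ two_pos, gain_succ]
    have := Nat.choose_le_choose (k + 1) (show P ≤ 2 * i by omega)
    zify at this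
    linarith
  · rw [show (2 * i + 1) / 2 = i by omega]

end BoundedMatching

namespace BoundedMatching

open SimpleGraph Finset

variable {V : Type*} [DecidableEq V] (G : SimpleGraph V)

open scoped Classical in
/-- The number of `r`-cliques of `G` inside `S`. -/
noncomputable def cliqueCount (r : ℕ) (S : Finset V) : ℕ :=
  #((S.powersetCard r).filter fun t : Finset V => G.IsClique (t : Set V))

open scoped Classical in
/-- The neighbours of `v` inside `S`. -/
noncomputable def nbrs (S : Finset V) (v : V) : Finset V := {u ∈ S | G.Adj v u}

/-- `G` has `k` independent edges inside `S`. -/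
def HasMatching : ℕ → Finset V → Prop
  | 0, _ => True
  | k + 1, S => ∃ u ∈ S, ∃ v ∈ S, G.Adj u v ∧ HasMatching k ((S.erase u).erase v)

variable {G}

omit [DecidableEq V] in
lemma mem_nbrs {S : Finset V} {u v : V} : u ∈ nbrs G S v ↔ u ∈ S ∧ G.Adj v u := by
  simp [nbrs]

omit [DecidableEq V] in
lemma nbrs_subset (S : Finset V) (v : V) : nbrs G S v ⊆ S := fun _ h => (mem_nbrs.1 h).1

lemma HasMatching.mono {k : ℕ} {S S' : Finset V} (h : HasMatching G k S) (hS : S ⊆ S') :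
    HasMatching G k S' := by
  induction k generalizing S S' with
  | zero => trivial
  | succ k ih =>
    obtain ⟨u, hu, v, hv, huv, hk⟩ := h
    exact ⟨u, hS hu, v, hS hv, huv, ih hk (erase_subset_erase _ (erase_subset_erase _ hS))⟩

lemma HasMatching.of_le {k k' : ℕ} {S : Finset V} (h : HasMatching G k S) (hk : k' ≤ k) :
    HasMatching G k' S := by
  induction k generalizing S k' with
  | zero => obtain rfl : k' = 0 := by omega
            trivial
  | succ k ih =>
    cases k' with
    | zero => trivial
    | succ k' =>
      obtain ⟨u, hu, v, hv, huv, hk'⟩ := h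
      exact ⟨u, hu, v, hv, huv, ih hk' (by omega)⟩

lemma HasMatching.union {k k' : ℕ} {S S' : Finset V} (h : HasMatching G k S)
    (h' : HasMatching G k' S') (hS : Disjoint S S') : HasMatching G (k + k') (S ∪ S') := by
  induction k generalizing S with
  | zero => rw [zero_add]; exact h'.mono subset_union_right
  | succ k ih =>
    obtain ⟨u, hu, v, hv, huv, hk⟩ := h
    rw [Nat.add_right_comm]
    refine ⟨u, mem_union_left _ hu, v, mem_union_left _ hv, huv, (ih hk ?_).mono ?_⟩
    · exact hS.mono_left ((erase_subset _ _).trans (erase_subset _ _))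
    · intro x hx
      have hu' := disjoint_left.1 hS hu
      have hv' := disjoint_left.1 hS hv
      simp only [mem_union, mem_erase] at hx ⊢
      rcases hx with hx | hx
      · tauto
      · exact ⟨fun h => hv' (h ▸ hx), fun h => hu' (h ▸ hx), Or.inr hx⟩

lemma hasMatching_of_complete {T Z : Finset V} (hTZ : ∀ t ∈ T, ∀ z ∈ Z, G.Adj t z)
    (hcard : #T ≤ #Z) : HasMatching G #T (T ∪ Z) := by
  induction T using Finset.induction_on generalizing Z with
  | empty => trivial
  | insert t T ht ih =>
    rw [card_insert_of_notMem ht] at hcard ⊢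
    obtain ⟨z, hz⟩ : Z.Nonempty := card_pos.1 (by omega)
    refine ⟨t, by simp, z, by simp [hz], hTZ t (by simp) z hz,
      (ih (Z := Z.erase z) (fun t' ht' z' hz' => hTZ t' (by simp [ht']) z' (mem_of_mem_erase hz'))
        (by rw [card_erase_of_mem hz]; omega)).mono ?_⟩
    intro x hx
    simp only [mem_union, mem_erase, mem_insert] at hx ⊢
    have hTz : ∀ t' ∈ insert t T, t' ≠ z := fun t' ht' => (hTZ t' ht' z hz).ne
    have hZt : ∀ z' ∈ Z, z' ≠ t := fun z' hz' => (hTZ t (by simp) z' hz').ne'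
    rcases hx with hx | hx
    · exact ⟨hTz x (by simp [hx]), fun h => ht (h ▸ hx), Or.inl (Or.inr hx)⟩
    · exact ⟨hx.1, hZt x hx.2, Or.inr hx.2⟩

lemma HasMatching.exists_fin {k : ℕ} {S : Finset V} (h : HasMatching G k S) :
    ∃ x y : Fin k → V, Function.Injective x ∧ Function.Injective y ∧ (∀ i j, x i ≠ y j) ∧
      (∀ i, G.Adj (x i) (y i)) ∧ (∀ i, x i ∈ S) ∧ ∀ i, y i ∈ S := by
  induction k generalizing S with
  | zero => exact ⟨Fin.elim0, Fin.elim0, fun i => i.elim0, fun i => i.elim0, fun i => i.elim0,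
      fun i => i.elim0, fun i => i.elim0, fun i => i.elim0⟩
  | succ k ih =>
    obtain ⟨u, hu, v, hv, huv, hk⟩ := h
    obtain ⟨x, y, hx, hy, hxy, hadj, hxS, hyS⟩ := ih hk
    simp only [mem_erase] at hxS hyS
    refine ⟨Fin.cons u x, Fin.cons v y, Fin.cons_injective_iff.2 ⟨?_, hx⟩,
      Fin.cons_injective_iff.2 ⟨?_, hy⟩, ?_, ?_, ?_, ?_⟩
    · rintro ⟨i, hi⟩; exact (hxS i).2.1 hi
    · rintro ⟨i, hi⟩; exact (hyS i).1 hi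
    · intro i j
      refine Fin.cases ?_ (fun i => ?_) i <;> refine Fin.cases ?_ (fun j => ?_) j
      · exact huv.ne
      · exact fun h => (hyS j).2.1 h.symm
      · exact (hxS i).1
      · exact hxy i j
    · exact Fin.cases huv hadj
    · exact Fin.cases hu fun i => (hxS i).2.2
    · exact Fin.cases hv fun i => (hyS i).2.2

lemma HasMatching.isContained {k : ℕ} {S : Finset V} (h : HasMatching G k S) :
    matching k ⊑ G := by
  obtain ⟨x, y, hx, hy, hxy, hadj, -, -⟩ := h.exists_fin
  refine ⟨⟨⟨fun e => if e.2 = 0 then x e.1 else y e.1, ?_⟩, ?_⟩⟩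
  · rintro ⟨i, a⟩ ⟨j, b⟩ ⟨hij, hab⟩
    obtain rfl : i = j := hij
    fin_cases a <;> fin_cases b <;> simp_all [hadj i, (hadj i).symm]
  · rintro ⟨i, a⟩ ⟨j, b⟩ h
    fin_cases a <;> fin_cases b <;> simp [hx.eq_iff, hy.eq_iff, hxy, (hxy _ _).symm] at h ⊢ <;>
      exact h

omit [DecidableEq V] in
lemma pathGraph_isContained_of_isChain {l : List V} (hl : l.IsChain G.Adj) (hn : l.Nodup) {m : ℕ}
    (hm : m ≤ l.length) : pathGraph m ⊑ G := by
  refine ⟨⟨⟨fun i => l[i.1], ?_⟩, ?_⟩⟩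
  · intro i j hij
    rw [pathGraph_adj] at hij
    rw [List.isChain_iff_getElem] at hl
    obtain ⟨i, hi⟩ := i
    obtain ⟨j, hj⟩ := j
    dsimp only at hij
    rcases hij with rfl | rfl
    · exact hl i (by omega)
    · exact (hl j (by omega)).symm
  · intro i j hij
    exact Fin.ext ((hn.getElem_inj_iff).1 hij)

lemma hasMatching_of_isChain : ∀ {l : List V}, l.IsChain G.Adj → l.Nodup →
    HasMatching G (l.length / 2) l.toFinset
  | [], _, _ => by simp [HasMatching]
  | [_], _, _ => by simp [HasMatching]
  | a :: b :: l, hl, hn => by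
    have ih := hasMatching_of_isChain (l := l) hl.tail.tail hn.tail.tail
    rw [show (a :: b :: l).length / 2 = l.length / 2 + 1 by simp; omega]
    simp only [List.nodup_cons, List.mem_cons, not_or] at hn
    refine ⟨a, by simp, b, by simp, (List.isChain_cons_cons.1 hl).1, ih.mono fun x hx => ?_⟩
    simp only [List.mem_toFinset, mem_erase, List.mem_cons] at hx ⊢
    exact ⟨fun h => hn.2.1 (h ▸ hx), fun h => hn.1.2 (h ▸ hx), Or.inr (Or.inr hx)⟩

omit [DecidableEq V] in
/-- A cycle together with a vertex attached to it contains a longer path. -/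
lemma exists_isChain_of_cycle {c : List V} (hc : c.IsChain G.Adj) (hn : c.Nodup)
    (hcl : ∀ b ∈ c.getLast?, ∀ a ∈ c.head?, G.Adj b a) {x y : V} (hx : x ∈ c) (hy : y ∉ c)
    (hxy : G.Adj x y) : ∃ l : List V, l.IsChain G.Adj ∧ l.Nodup ∧ l.length = c.length + 1 ∧
      ∀ z ∈ l, z = y ∨ z ∈ c := by
  obtain ⟨c₁, c₂, rfl⟩ := List.append_of_mem hx
  rw [List.isChain_append] at hc
  refine ⟨y :: (x :: c₂ ++ c₁), ?_, ?_, ?_, ?_⟩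
  · rw [List.cons_append, List.isChain_cons_cons, ← List.cons_append, List.isChain_append]
    refine ⟨hxy.symm, hc.2.1, hc.1, fun b hb a ha => hcl b ?_ a ?_⟩
    · rw [List.getLast?_append]; simp at hb ⊢; simp [hb]
    · cases c₁ with
      | nil => simp at ha
      | cons => simpa using ha
  · rw [List.nodup_cons]
    refine ⟨?_, List.nodup_append_comm.1 hn⟩
    simp at hy ⊢; tauto
  · simp; omega
  · intro z hz; simp at hz ⊢; tauto

/-- Dirac's argument: if all degrees inside `S` exceed `P` and every path has at most `2 P + 2`
vertices, then a longest path closes up to a cycle and spans a component. -/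
lemma exists_closed_path {P : ℕ} {S : Finset V} (hS : S.Nonempty)
    (hpath : ∀ l : List V, l.IsChain G.Adj → l.Nodup → l.length ≤ 2 * P + 2)
    (hdeg : ∀ v ∈ S, P + 1 ≤ #(nbrs G S v)) :
    ∃ l : List V, l.IsChain G.Adj ∧ l.Nodup ∧ (∀ x ∈ l, x ∈ S) ∧ P + 2 ≤ l.length ∧
      ∀ x ∈ l, ∀ y ∈ S, G.Adj x y → y ∈ l := by
  classical
  obtain ⟨l, ⟨hl, hn, hlS⟩, hmax⟩ : ∃ l : List V,
      (l.IsChain G.Adj ∧ l.Nodup ∧ ∀ x ∈ l, x ∈ S) ∧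
      ∀ l' : List V, l'.IsChain G.Adj → l'.Nodup → (∀ x ∈ l', x ∈ S) → l'.length ≤ l.length := by
    let Q (m : ℕ) : Prop := ∃ l : List V, (l.IsChain G.Adj ∧ l.Nodup ∧ ∀ x ∈ l, x ∈ S) ∧
      l.length = m
    have h0 : Q (Nat.findGreatest Q (2 * P + 2)) :=
      Nat.findGreatest_spec (P := Q) (Nat.zero_le _) ⟨[], by simp, rfl⟩
    obtain ⟨l, hl, hlen⟩ := h0
    refine ⟨l, hl, fun l' h1 h2 h3 => hlen ▸ ?_⟩
    exact Nat.le_findGreatest (hpath l' h1 h2) ⟨l', ⟨h1, h2, h3⟩, rfl⟩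
  have hlen : 0 < l.length := by
    obtain ⟨v, hv⟩ := hS
    have := hmax [v] (by simp) (by simp) (by simpa using hv)
    simpa [Nat.succ_le_iff] using this
  have hfirst : ∀ y ∈ S, G.Adj l[0] y → y ∈ l := by
    intro y hy hadj
    by_contra hyl
    have := hmax (y :: l) ?_ (List.nodup_cons.2 ⟨hyl, hn⟩) ?_
    · simp at this
    · rw [List.isChain_cons]
      refine ⟨fun z hz => ?_, hl⟩
      rw [List.head?_eq_getElem?, List.getElem?_eq_getElem hlen] at hz
      simp only [Option.mem_def, Option.some.injEq] at hz
      exact hz ▸ hadj.symm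
    · simpa [hy] using hlS
  have hlast : ∀ y ∈ S, G.Adj (l[l.length - 1]) y → y ∈ l := by
    intro y hy hadj
    by_contra hyl
    have := hmax (l ++ [y]) ?_ ?_ ?_
    · simp at this
    · rw [List.isChain_append]
      refine ⟨hl, by simp, fun z hz => ?_⟩
      rw [List.getLast?_eq_getElem?, List.getElem?_eq_getElem (by omega)] at hz
      simp only [Option.mem_def, Option.some.injEq] at hz
      simpa [← hz] using hadj
    · rw [List.nodup_append]
      exact ⟨hn, by simp, by rintro a ha b hb rfl; simp at hb; exact hyl (hb ▸ ha)⟩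
    · intro x hx
      simp at hx
      rcases hx with hx | rfl
      exacts [hlS x hx, hy]
  have hbound := hpath l hl hn
  obtain ⟨N, hN⟩ : ∃ N, l.length = N + 1 := ⟨l.length - 1, by omega⟩
  let f (i : ℕ) : V := l.getD i l[0]
  have hf (i : ℕ) (hi : i < l.length) : f i = l[i] := by simp [f, hi]
  have hA : P + 1 ≤ #{i ∈ range N | G.Adj l[0] (f (i + 1))} := by
    refine (hdeg _ (hlS _ (List.getElem_mem hlen))).trans
      ((card_le_card ?_).trans (card_image_le (f := fun i => f (i + 1))))
    intro y hy
    rw [mem_nbrs] at hy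
    obtain ⟨i, hi, hiy⟩ := List.mem_iff_getElem.1 (hfirst y hy.1 hy.2)
    cases i with
    | zero => exact absurd hiy hy.2.ne
    | succ i =>
      refine mem_image.2 ⟨i, ?_, by rw [hf _ hi, hiy]⟩
      rw [mem_filter, hf _ hi, hiy, mem_range]
      exact ⟨by omega, hy.2⟩
  have hB : P + 1 ≤ #{i ∈ range N | G.Adj (l[l.length - 1]) (f i)} := by
    refine (hdeg (l[l.length - 1]) (hlS _ (List.getElem_mem _))).trans
      ((card_le_card ?_).trans (card_image_le (f := f)))
    intro y hy
    rw [mem_nbrs] at hy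
    obtain ⟨i, hi, hiy⟩ := List.mem_iff_getElem.1 (hlast y hy.1 hy.2)
    refine mem_image.2 ⟨i, ?_, by rw [hf _ hi, hiy]⟩
    rw [mem_filter, hf _ hi, hiy, mem_range]
    refine ⟨?_, hy.2⟩
    have : i ≠ N := by
      rintro rfl
      apply hy.2.ne
      rw [← hiy]
      congr
      omega
    omega
  have hPN : P + 1 ≤ N := by
    simpa using hA.trans (card_filter_le _ _)
  obtain ⟨i, hi⟩ : ({i ∈ range N | G.Adj l[0] (f (i + 1))} ∩
      {i ∈ range N | G.Adj (l[l.length - 1]) (f i)}).Nonempty := by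
    apply inter_nonempty_of_card_lt_card_add_card (s := range N) (filter_subset _ _)
      (filter_subset _ _)
    rw [card_range]
    omega
  simp only [mem_inter, mem_filter, mem_range] at hi
  obtain ⟨⟨hiN, hi1⟩, -, hi2⟩ := hi
  rw [hf _ (by omega)] at hi1 hi2
  refine ⟨l, hl, hn, hlS, by omega, ?_⟩
  intro x hx y hy hxy
  by_contra hyl
  have hperm : (l.take (i + 1) ++ (l.drop (i + 1)).reverse).Perm l := by
    conv_rhs => rw [← List.take_append_drop (i + 1) l]
    exact (List.Perm.refl _).append (List.reverse_perm _)
  have hchain : (l.take (i + 1) ++ (l.drop (i + 1)).reverse).IsChain G.Adj := by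
    rw [List.isChain_append, List.isChain_reverse]
    refine ⟨hl.take _, (hl.drop _).imp fun _ _ h => h.symm, fun b hb a ha => ?_⟩
    rw [List.getLast?_take, List.getElem?_eq_getElem (by omega)] at hb
    rw [List.head?_reverse, List.getLast?_drop, if_neg (by omega), List.getLast?_eq_getElem?,
      List.getElem?_eq_getElem (by omega)] at ha
    simp at ha hb
    rw [← ha, ← hb]
    exact hi2.symm
  have hclose : ∀ b ∈ (l.take (i + 1) ++ (l.drop (i + 1)).reverse).getLast?,
      ∀ a ∈ (l.take (i + 1) ++ (l.drop (i + 1)).reverse).head?, G.Adj b a := by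
    intro b hb a ha
    rw [List.getLast?_append, List.getLast?_reverse, List.head?_drop,
      List.getElem?_eq_getElem (by omega)] at hb
    rw [List.head?_append, List.head?_take, if_neg (by omega), List.head?_eq_getElem?,
      List.getElem?_eq_getElem (by omega)] at ha
    simp at ha hb
    rw [← ha, ← hb]
    exact hi1.symm
  obtain ⟨l', h1, h2, h3, h4⟩ := exists_isChain_of_cycle hchain (hperm.nodup_iff.2 hn) hclose
    (hperm.mem_iff.2 hx) (fun h => hyl (hperm.mem_iff.1 h)) hxy
  have := hmax l' h1 h2 (fun z hz => by
    rcases h4 z hz with rfl | hz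
    exacts [hy, hlS z (hperm.mem_iff.1 hz)])
  rw [h3, hperm.length_eq] at this
  omega

end BoundedMatching

namespace BoundedMatching

open SimpleGraph Finset

section CliqueCount

variable {V : Type*} [DecidableEq V] {G : SimpleGraph V}

lemma cliqueCount_le_choose (r : ℕ) (S : Finset V) : cliqueCount G r S ≤ (#S).choose r := by
  classical
  exact (card_filter_le _ _).trans_eq (card_powersetCard r S)

lemma cliqueCount_union_le (r : ℕ) {D R : Finset V}
    (h : ∀ x ∈ D, ∀ y ∈ R, y ∉ D → ¬ G.Adj x y) :
    cliqueCount G r (D ∪ R) ≤ cliqueCount G r D + cliqueCount G r R := by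
  classical
  refine (card_le_card fun t ht => ?_).trans (card_union_le _ _)
  simp only [mem_union, mem_filter, mem_powersetCard] at ht ⊢
  obtain ⟨⟨hsub, hcard⟩, hcl⟩ := ht
  by_cases hD : t ⊆ D
  · exact Or.inl ⟨⟨hD, hcard⟩, hcl⟩
  · refine Or.inr ⟨⟨fun x hx => ?_, hcard⟩, hcl⟩
    obtain ⟨y, hy, hyD⟩ := not_subset.1 hD
    by_contra hxR
    have hxD : x ∈ D := (mem_union.1 (hsub hx)).resolve_right hxR
    have hyR : y ∈ R := (mem_union.1 (hsub hy)).resolve_left hyD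
    exact h x hxD y hyR hyD (hcl hx hy fun hxy => hyD (hxy ▸ hxD))

lemma cliqueCount_insert_le (r : ℕ) (S : Finset V) {v : V} (hv : v ∉ S) :
    cliqueCount G (r + 1) (insert v S) ≤
      cliqueCount G (r + 1) S + (#(nbrs G S v)).choose r := by
  classical
  unfold cliqueCount
  rw [powersetCard_succ_insert hv, filter_union]
  refine (card_union_le _ _).trans (Nat.add_le_add_left ?_ _)
  rw [filter_image, ← card_powersetCard]
  refine card_image_le.trans (card_le_card fun t ht => ?_)
  simp only [mem_filter, mem_powersetCard] at ht ⊢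
  refine ⟨fun x hx => mem_nbrs.2 ⟨ht.1.1 hx, ?_⟩, ht.1.2⟩
  exact ht.2 (by simp) (by simp [hx]) fun h => hv (h ▸ ht.1.1 hx)

/-- Successively deleting vertices of degree at most `P` outside `T`. -/
lemma exists_peeled (P k : ℕ) (T S : Finset V) (hTS : T ⊆ S) :
    ∃ S', T ⊆ S' ∧ S' ⊆ S ∧ (∀ v ∈ S', v ∉ T → P + 1 ≤ #(nbrs G S' v)) ∧
      cliqueCount G (k + 2) S + #S' * P.choose (k + 1) ≤
        cliqueCount G (k + 2) S' + #S * P.choose (k + 1) := by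
  induction S using Finset.strongInduction with
  | H S ih =>
    by_cases h : ∀ v ∈ S, v ∉ T → P + 1 ≤ #(nbrs G S v)
    · exact ⟨S, hTS, Subset.rfl, h, le_rfl⟩
    · push Not at h
      obtain ⟨v, hv, hvT, hdeg⟩ := h
      obtain ⟨S', h1, h2, h3, h4⟩ := ih (S.erase v) (erase_ssubset hv)
        (fun x hx => mem_erase.2 ⟨fun h => hvT (h ▸ hx), hTS hx⟩)
      refine ⟨S', h1, h2.trans (erase_subset _ _), h3, ?_⟩
      have h5 := cliqueCount_insert_le (G := G) (k + 1) (S.erase v) (notMem_erase v S)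
      rw [insert_erase hv, show k + 1 + 1 = k + 2 from rfl] at h5
      have h6 : (#(nbrs G (S.erase v) v)).choose (k + 1) ≤ P.choose (k + 1) := by
        apply Nat.choose_le_choose
        have : nbrs G (S.erase v) v ⊆ nbrs G S v := fun x hx =>
          mem_nbrs.2 ⟨mem_of_mem_erase (mem_nbrs.1 hx).1, (mem_nbrs.1 hx).2⟩
        have := card_le_card this
        omega
      have h7 : #S = #(S.erase v) + 1 := (card_erase_add_one hv).symm
      rw [h7, Nat.add_mul]
      omega

/-- The bound for a graph all of whose degrees exceed `P` and whose paths have at most `2 P + 2`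
vertices: it is no better than a disjoint union of cliques `K_{2P+2}`, `K_{2P+1}` and at most one
smaller odd clique. -/
lemma exists_clique_union_bound {P : ℕ} (k : ℕ) (hP : 1 ≤ P)
    (hpath : ∀ l : List V, l.IsChain G.Adj → l.Nodup → l.length ≤ 2 * P + 2) (S : Finset V)
    (hdeg : ∀ v ∈ S, P + 1 ≤ #(nbrs G S v)) :
    ∃ a b j : ℕ, j ≤ P ∧ HasMatching G (a * (P + 1) + b * P + j) S ∧
      (cliqueCount G (k + 2) S : ℤ) ≤ #S * (P.choose (k + 1) : ℤ) + (a * gain P k (2 * P + 2) +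
        b * gain P k (lastOrder P) + gain P k (lastOrder j)) := by
  have hsys := gainSystem P k hP
  induction S using Finset.strongInduction with
  | H S ih =>
    rcases S.eq_empty_or_nonempty with rfl | hne
    · refine ⟨0, 0, 0, by omega, by simp [HasMatching], ?_⟩
      have := cliqueCount_le_choose (G := G) (k + 2) (∅ : Finset V)
      simp at this
      simp [this, gain, lastOrder]
    obtain ⟨l, hl, hn, hlS, hlen, hclosed⟩ := exists_closed_path hne hpath hdeg
    have hlen' := hpath l hl hn
    have hDS : l.toFinset ⊆ S := fun x hx => hlS x (List.mem_toFinset.1 hx)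
    have hDcard : #l.toFinset = l.length := List.toFinset_card_of_nodup hn
    obtain ⟨a, b, j, hj, hmatch, hcount⟩ := ih (S \ l.toFinset) (by
        refine sdiff_ssubset hDS (card_pos.1 ?_)
        rw [hDcard]
        omega) (by
      intro v hv
      rw [mem_sdiff] at hv
      refine (hdeg v hv.1).trans (card_le_card fun x hx => ?_)
      rw [mem_nbrs] at hx ⊢
      refine ⟨mem_sdiff.2 ⟨hx.1, fun hxl => hv.2 ?_⟩, hx.2⟩
      exact List.mem_toFinset.2 (hclosed x (List.mem_toFinset.1 hxl) v hv.1 hx.2.symm))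
    have hmatch' := (hasMatching_of_isChain hl hn).union hmatch disjoint_sdiff
    have hcount' := cliqueCount_union_le (G := G) (k + 2) (D := l.toFinset)
      (R := S \ l.toFinset) (fun x hx y hy hyD hadj => hyD (List.mem_toFinset.2
        (hclosed x (List.mem_toFinset.1 hx) y (mem_sdiff.1 hy).1 hadj)))
    rw [union_sdiff_of_subset hDS] at hmatch' hcount'
    have hclique := cliqueCount_le_choose (G := G) (k + 2) l.toFinset
    have hcard := card_sdiff_add_card_eq_card hDS
    rw [hDcard] at hclique hcard
    have hgain : gain P k l.length = (l.length.choose (k + 2) : ℤ) -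
      l.length * (P.choose (k + 1) : ℤ) := rfl
    have hcard' : (#S : ℤ) * (P.choose (k + 1) : ℤ) = #(S \ l.toFinset) * (P.choose (k + 1) : ℤ) +
        l.length * (P.choose (k + 1) : ℤ) := by
      rw [← hcard]; push_cast; ring
    zify at hclique hcount'
    have hbase : (cliqueCount G (k + 2) S : ℤ) ≤ #S * (P.choose (k + 1) : ℤ) +
        (a * gain P k (2 * P + 2) + b * gain P k (lastOrder P) + gain P k (lastOrder j) +
          gain P k l.length) := by linarith
    by_cases hfull : l.length = 2 * P + 2
    · refine ⟨a + 1, b, j, hj, hmatch'.of_le ?_, ?_⟩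
      · rw [hfull, show (2 * P + 2) / 2 = P + 1 by omega, Nat.add_mul]
        omega
      · rw [hfull] at hbase
        push_cast
        linarith
    have hi : l.length / 2 ≤ P := by omega
    have hgi : gain P k l.length ≤ gain P k (lastOrder (l.length / 2)) :=
      gain_le_gain_lastOrder (by omega) (by omega)
    have hmerge := hsys.merge hi hj
    by_cases hij : l.length / 2 + j ≤ P
    · refine ⟨a, b, l.length / 2 + j, hij, hmatch'.of_le (by omega), ?_⟩
      linarith [hmerge.1]
    · refine ⟨a, b + 1, l.length / 2 + j - P, by omega, hmatch'.of_le ?_, ?_⟩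
      · rw [Nat.add_mul]; omega
      · push_cast
        linarith [hmerge.2 (by omega)]

end CliqueCount

section Structure

variable {V : Type*} [DecidableEq V] {G : SimpleGraph V}

/-- A path alternating between `T` and its common neighbours, with prescribed ends. -/
lemma exists_alternating_path {n : ℕ} : ∀ {T Z : Finset V} {t w : V}, #T = n + 1 → t ∈ T →
    n ≤ #Z → w ∉ Z → (∀ x ∈ T, ∀ z ∈ Z, G.Adj x z) → (∀ x ∈ T, G.Adj x w) →
    ∃ l : List V, l.IsChain G.Adj ∧ l.Nodup ∧ l.head? = some t ∧ l.getLast? = some w ∧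
      l.length = 2 * n + 2 ∧ ∀ x ∈ l, x ∈ T ∨ x ∈ Z ∨ x = w := by
  induction n with
  | zero =>
    intro T Z t w hT ht hZ hw hTZ hTw
    refine ⟨[t, w], by simp [hTw t ht], by simp [(hTw t ht).ne], rfl, rfl, rfl, ?_⟩
    intro x hx
    simp at hx
    rcases hx with rfl | rfl <;> simp [ht]
  | succ n ih =>
    intro T Z t w hT ht hZ hw hTZ hTw
    obtain ⟨t', ht'⟩ : (T.erase t).Nonempty := card_pos.1 (by rw [card_erase_of_mem ht]; omega)
    obtain ⟨z, hz⟩ : Z.Nonempty := card_pos.1 (by omega)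
    obtain ⟨l, h1, h2, h3, h4, h5, h6⟩ := ih (T := T.erase t) (Z := Z.erase z) (t := t') (w := w)
      (by rw [card_erase_of_mem ht]; omega) ht' (by rw [card_erase_of_mem hz]; omega)
      (fun h => hw (mem_of_mem_erase h))
      (fun x hx y hy => hTZ x (mem_of_mem_erase hx) y (mem_of_mem_erase hy))
      (fun x hx => hTw x (mem_of_mem_erase hx))
    have htz := hTZ t ht z hz
    obtain ⟨l', rfl⟩ : ∃ l', l = t' :: l' := by
      cases l with
      | nil => simp at h3
      | cons a l' => simp at h3; exact ⟨l', by rw [h3]⟩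
    have htl : t ∉ t' :: l' := by
      intro h
      rcases h6 t h with h | h | h
      · exact notMem_erase _ _ h
      · exact (hTZ t ht t (mem_of_mem_erase h)).ne rfl
      · exact (h ▸ hTw t ht).ne rfl
    have hzl : z ∉ t' :: l' := by
      intro h
      rcases h6 z h with h | h | h
      · exact (hTZ z (mem_of_mem_erase h) z hz).ne rfl
      · exact notMem_erase _ _ h
      · exact hw (h ▸ hz)
    refine ⟨t :: z :: t' :: l', ?_, ?_, rfl, ?_, ?_, ?_⟩
    · exact List.isChain_cons_cons.2 ⟨htz, List.isChain_cons_cons.2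
        ⟨(hTZ t' (mem_of_mem_erase ht') z hz).symm, h1⟩⟩
    · rw [List.nodup_cons, List.nodup_cons]
      refine ⟨?_, hzl, h2⟩
      rw [List.mem_cons, not_or]
      exact ⟨htz.ne, htl⟩
    · rw [← h4]; simp
    · rw [List.length_cons, List.length_cons, h5]; omega
    · intro x hx
      rw [List.mem_cons, List.mem_cons] at hx
      rcases hx with rfl | rfl | hx
      · simp [ht]
      · simp [hz]
      · rcases h6 x hx with h | h | h
        · exact Or.inl (mem_of_mem_erase h)
        · exact Or.inr (Or.inl (mem_of_mem_erase h))
        · exact Or.inr (Or.inr h)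

variable {P : ℕ} {T X : Finset V}

/-- No path on three vertices outside `T` starts at a neighbour of `T`. -/
lemma not_path_three (hP : 1 ≤ P) (hT : #T = P) (hX : P + 4 ≤ #X)
    (hTX : ∀ t ∈ T, ∀ x ∈ X, G.Adj t x)
    (hpath : ∀ l : List V, l.IsChain G.Adj → l.Nodup → l.length ≤ 2 * P + 2)
    {t x y z : V} (ht : t ∈ T) (hx : x ∉ T) (hy : y ∉ T) (hz : z ∉ T) (hxt : G.Adj x t)
    (hxy : G.Adj x y) (hyz : G.Adj y z) : z = x := by
  by_contra hzx
  obtain ⟨n, rfl⟩ : ∃ n, P = n + 1 := ⟨P - 1, by omega⟩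
  have hF : #({x, y, z} : Finset V) ≤ 3 := card_le_three
  have hX' := le_card_sdiff {x, y, z} X
  obtain ⟨w, hw⟩ : (X \ {x, y, z}).Nonempty := card_pos.1 (by omega)
  have hw' := mem_sdiff.1 hw
  have hc := card_erase_of_mem hw
  obtain ⟨l, h1, h2, h3, h4, h5, h6⟩ := exists_alternating_path (G := G) (n := n) (T := T)
    (Z := (X \ {x, y, z}).erase w) (t := t) (w := w) hT ht (by omega) (notMem_erase _ _)
    (fun t' ht' z' hz' => hTX t' ht' z' (mem_sdiff.1 (mem_of_mem_erase hz')).1)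
    (fun t' ht' => hTX t' ht' w hw'.1)
  have hnot : ∀ v ∈ ({x, y, z} : Finset V), v ∉ T → v ∉ l := by
    intro v hv hvT hvl
    rcases h6 v hvl with h | h | h
    · exact hvT h
    · exact (mem_sdiff.1 (mem_of_mem_erase h)).2 hv
    · exact hw'.2 (h ▸ hv)
  obtain ⟨l', rfl⟩ : ∃ l', l = t :: l' := by
    cases l with
    | nil => simp at h3
    | cons a l' => simp at h3; exact ⟨l', by rw [h3]⟩
  have := hpath (z :: y :: x :: t :: l') ?_ ?_
  · rw [List.length_cons, List.length_cons, List.length_cons, h5] at this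
    omega
  · exact List.isChain_cons_cons.2 ⟨hyz.symm, List.isChain_cons_cons.2 ⟨hxy.symm,
      List.isChain_cons_cons.2 ⟨hxt, h1⟩⟩⟩
  · refine List.nodup_cons.2 ⟨fun h => ?_, List.nodup_cons.2 ⟨fun h => ?_,
      List.nodup_cons.2 ⟨hnot x (by simp) hx, h2⟩⟩⟩
    · rcases List.mem_cons.1 h with h | h
      · exact hyz.ne' h
      · rcases List.mem_cons.1 h with h | h
        exacts [hzx h, hnot z (by simp) hz h]
    · rcases List.mem_cons.1 h with h | h
      exacts [hxy.ne' h, hnot y (by simp) hy h]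

/-- There are no two disjoint edges outside `T`, one of them attached to `T` and the other one
containing a vertex complete to `T`. -/
lemma not_two_edges (hP : 1 ≤ P) (hT : #T = P) (hX : P + 4 ≤ #X)
    (hTX : ∀ t ∈ T, ∀ x ∈ X, G.Adj t x)
    (hpath : ∀ l : List V, l.IsChain G.Adj → l.Nodup → l.length ≤ 2 * P + 2)
    {t x y x' y' : V} (ht : t ∈ T) (hx : x ∉ T) (hy : y ∉ T) (hy' : y' ∉ T)
    (hxt : G.Adj x t) (hxy : G.Adj x y) (hxy' : G.Adj x' y') (hcomp : ∀ t ∈ T, G.Adj t x')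
    (h1 : x ≠ x') (h2 : x ≠ y') (h3 : y ≠ x') (h4 : y ≠ y') : False := by
  obtain ⟨n, rfl⟩ : ∃ n, P = n + 1 := ⟨P - 1, by omega⟩
  have hF : #({x, y, x', y'} : Finset V) ≤ 4 := card_le_four
  have hX' := le_card_sdiff {x, y, x', y'} X
  obtain ⟨l, g1, g2, g3, g4, g5, g6⟩ := exists_alternating_path (G := G) (n := n) (T := T)
    (Z := X \ {x, y, x', y'}) (t := t) (w := x') hT ht (by omega) (by simp)
    (fun t' ht' z' hz' => hTX t' ht' z' (mem_sdiff.1 hz').1) hcomp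
  have hnot : ∀ v ∈ ({x, y, x', y'} : Finset V), v ∉ T → v ≠ x' → v ∉ l := by
    intro v hv hvT hvx hvl
    rcases g6 v hvl with h | h | h
    · exact hvT h
    · exact (mem_sdiff.1 h).2 hv
    · exact hvx h
  obtain ⟨l', rfl⟩ : ∃ l', l = t :: l' := by
    cases l with
    | nil => simp at g3
    | cons a l' => simp at g3; exact ⟨l', by rw [g3]⟩
  have := hpath (y :: x :: t :: l' ++ [y']) ?_ ?_
  · simp at this g5
    omega
  · rw [List.isChain_append]
    refine ⟨List.isChain_cons_cons.2 ⟨hxy.symm, List.isChain_cons_cons.2 ⟨hxt, g1⟩⟩, by simp, ?_⟩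
    intro a ha b hb
    have ha' : x' = a := by simpa [g4] using ha
    have hb' : y' = b := by simpa using hb
    rw [← ha', ← hb']
    exact hxy'
  · rw [List.nodup_append, List.nodup_cons, List.nodup_cons, List.mem_cons, not_or]
    refine ⟨⟨⟨hxy.ne', hnot y (by simp) hy h3⟩, hnot x (by simp) hx h1, g2⟩, by simp, ?_⟩
    rintro a ha b hb rfl
    rw [List.mem_singleton] at hb
    subst hb
    rw [List.mem_cons, List.mem_cons] at ha
    rcases ha with h | h | h
    · exact h4 h.symm
    · exact h2 h.symm
    · exact hnot _ (by simp) hy' hxy'.ne' h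

/-- After peeling, `T` is either a component or extends to one by a single edge complete to `T`. -/
lemma component_of_core (hP : 1 ≤ P) (hT : #T = P) (hX : P + 4 ≤ #X)
    (hTX : ∀ t ∈ T, ∀ x ∈ X, G.Adj t x)
    (hpath : ∀ l : List V, l.IsChain G.Adj → l.Nodup → l.length ≤ 2 * P + 2)
    {S : Finset V} (hdeg : ∀ v ∈ S, v ∉ T → P + 1 ≤ #(nbrs G S v)) :
    (∀ v ∈ S, v ∉ T → ∀ t ∈ T, ¬ G.Adj v t) ∨
    ∃ x ∈ S, ∃ y ∈ S, x ∉ T ∧ y ∉ T ∧ G.Adj x y ∧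
      ∀ v ∈ S, v ∉ T → v ≠ x → v ≠ y → ¬ G.Adj v x ∧ ¬ G.Adj v y ∧ ∀ t ∈ T, ¬ G.Adj v t := by
  have key : ∀ x ∈ S, x ∉ T → ∀ t ∈ T, G.Adj x t → ∃ y ∈ S, y ∉ T ∧ G.Adj x y ∧
      (∀ t ∈ T, G.Adj y t) ∧ ∀ z ∈ S, z ∉ T → G.Adj y z → z = x := by
    intro x hxS hxT t ht hxt
    obtain ⟨y, hy, hyT⟩ : ∃ y ∈ nbrs G S x, y ∉ T :=
      exists_mem_notMem_of_card_lt_card (by have := hdeg x hxS hxT; omega)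
    rw [mem_nbrs] at hy
    have huniq : ∀ z, z ∉ T → G.Adj y z → z = x := fun z hz hyz =>
      not_path_three hP hT hX hTX hpath ht hxT hyT hz hxt hy.2 hyz
    refine ⟨y, hy.1, hyT, hy.2, ?_, fun z _ => huniq z⟩
    have hsub : nbrs G T y = T := by
      apply eq_of_subset_of_card_le (nbrs_subset _ _)
      have h1 : nbrs G S y ⊆ insert x (nbrs G T y) := by
        intro z hz
        rw [mem_nbrs] at hz
        rw [mem_insert, mem_nbrs]
        by_cases hzT : z ∈ T
        · exact Or.inr ⟨hzT, hz.2⟩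
        · exact Or.inl (huniq z hzT hz.2)
      have h2 := (card_le_card h1).trans (card_insert_le _ _)
      have h3 := hdeg y hy.1 hyT
      omega
    intro t' ht'
    rw [← hsub, mem_nbrs] at ht'
    exact ht'.2
  by_cases h : ∀ v ∈ S, v ∉ T → ∀ t ∈ T, ¬ G.Adj v t
  · exact Or.inl h
  push Not at h
  obtain ⟨x, hxS, hxT, t, ht, hxt⟩ := h
  obtain ⟨y, hyS, hyT, hxy, hyc, hyu⟩ := key x hxS hxT t ht hxt
  obtain ⟨x', hx'S, hx'T, hyx', -, hxu⟩ := key y hyS hyT t ht (hyc t ht)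
  obtain rfl : x' = x := hyu x' hx'S hx'T hyx'
  refine Or.inr ⟨x', hxS, y, hyS, hxT, hyT, hxy, fun v hvS hvT hvx hvy => ?_⟩
  have hv1 : ¬ G.Adj v x' := fun h => hvy (hxu v hvS hvT h.symm)
  have hv2 : ¬ G.Adj v y := fun h => hvx (hyu v hvS hvT h.symm)
  refine ⟨hv1, hv2, fun t' ht' hvt => ?_⟩
  obtain ⟨u, huS, huT, hvu, huc, -⟩ := key v hvS hvT t' ht' hvt
  refine not_two_edges hP hT hX hTX hpath ht hxT hyT hvT hxt hxy hvu.symm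
    (fun t ht => (huc t ht).symm) ?_ hvx.symm ?_ hvy.symm
  · rintro rfl; exact hv1 hvu
  · rintro rfl; exact hv2 hvu

end Structure

section UpperBound

variable {V : Type*} [DecidableEq V] [Fintype V] {G : SimpleGraph V}

lemma cliqueCount_le_of_core {P k c d : ℕ} {T X : Finset V} {M : ℤ} (hP : 1 ≤ P) (hT : #T = P)
    (hX : P + 4 ≤ #X) (hTX : ∀ t ∈ T, ∀ x ∈ X, G.Adj t x)
    (hpath : ∀ l : List V, l.IsChain G.Adj → l.Nodup → l.length ≤ 2 * P + 2)
    (hmatch : ¬ HasMatching G (P + (c * (P + 1) + d) + 1) univ) (hd : d ≤ P)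
    (hM : Dominates P c d (gain P k (2 * P + 2)) (P.choose k)
      (fun j => gain P k (lastOrder j)) M) :
    (cliqueCount G (k + 2) univ : ℤ) ≤
      Fintype.card V * (P.choose (k + 1) : ℤ) + gain P k P + M := by
  have hsys := gainSystem P k hP
  obtain ⟨S, hTS, -, hdeg, hpeel⟩ := exists_peeled (G := G) P k T univ (subset_univ T)
  rw [card_univ] at hpeel
  zify at hpeel
  obtain ⟨t₀, ht₀⟩ : T.Nonempty := card_pos.1 (by omega)
  have hdisj : Disjoint T X := Finset.disjoint_left.2 fun x hx hx' => (hTX x hx x hx').ne rfl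
  rcases component_of_core hP hT hX hTX hpath hdeg with h | ⟨x, hxS, y, hyS, hxT, hyT, hxy, h⟩
  · have hdegR : ∀ v ∈ S \ T, P + 1 ≤ #(nbrs G (S \ T) v) := by
      intro v hv
      rw [mem_sdiff] at hv
      refine (hdeg v hv.1 hv.2).trans (card_le_card fun u hu => ?_)
      rw [mem_nbrs] at hu ⊢
      exact ⟨mem_sdiff.2 ⟨hu.1, fun huT => h v hv.1 hv.2 u huT hu.2⟩, hu.2⟩
    obtain ⟨a, b, j, hj, hm, hc⟩ := exists_clique_union_bound k hP hpath (S \ T) hdegR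
    have hm' : HasMatching G (P + (a * (P + 1) + b * P + j)) univ := by
      have h1 := hasMatching_of_complete hTX (by omega)
      rw [hT] at h1
      refine (h1.union hm ?_).mono (subset_univ _)
      rw [disjoint_union_left]
      refine ⟨disjoint_sdiff, Finset.disjoint_left.2 fun v hv hvR => ?_⟩
      rw [mem_sdiff] at hvR
      exact h v hvR.1 hvR.2 t₀ ht₀ (hTX t₀ ht₀ v hv).symm
    have hle : a * (P + 1) + b * P + j ≤ c * (P + 1) + d := by
      by_contra hcon
      exact hmatch (hm'.of_le (by omega))
    have hbound := hsys.bound hM hd a b j hj hle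
    have hsplit := cliqueCount_union_le (G := G) (k + 2) (D := T) (R := S \ T)
      (fun t ht v hv hvT hadj => h v (mem_sdiff.1 hv).1 hvT t ht hadj.symm)
    rw [union_sdiff_of_subset hTS] at hsplit
    have hchoose := cliqueCount_le_choose (G := G) (k + 2) T
    have hcard := card_sdiff_add_card_eq_card hTS
    rw [hT] at hchoose hcard
    have hg : gain P k P = (P.choose (k + 2) : ℤ) - P * (P.choose (k + 1) : ℤ) := rfl
    have hcard' : (#S : ℤ) * (P.choose (k + 1) : ℤ) =
        #(S \ T) * (P.choose (k + 1) : ℤ) + P * (P.choose (k + 1) : ℤ) := by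
      rw [← hcard]; push_cast; ring
    zify at hsplit hchoose
    linarith
  · set D : Finset V := insert x (insert y T) with hD
    have hDS : D ⊆ S := by
      rw [hD, insert_subset_iff, insert_subset_iff]
      exact ⟨hxS, hyS, hTS⟩
    have hDcard : #D = P + 2 := by
      rw [hD, card_insert_of_notMem (by simp [hxT, hxy.ne]), card_insert_of_notMem hyT, hT]
    have hsep : ∀ v ∈ S, v ∉ D → ∀ u ∈ D, ¬ G.Adj v u := by
      intro v hv hvD u hu
      simp only [hD, mem_insert, not_or] at hvD hu
      obtain ⟨h1, h2, h3⟩ := h v hv hvD.2.2 hvD.1 hvD.2.1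
      rcases hu with rfl | rfl | hu
      exacts [h1, h2, h3 u hu]
    have hdegR : ∀ v ∈ S \ D, P + 1 ≤ #(nbrs G (S \ D) v) := by
      intro v hv
      rw [mem_sdiff] at hv
      have hvT : v ∉ T := fun h => hv.2 (by simp [hD, h])
      refine (hdeg v hv.1 hvT).trans (card_le_card fun u hu => ?_)
      rw [mem_nbrs] at hu ⊢
      exact ⟨mem_sdiff.2 ⟨hu.1, fun huD => hsep v hv.1 hv.2 u huD hu.2⟩, hu.2⟩
    obtain ⟨a, b, j, hj, hm, hc⟩ := exists_clique_union_bound k hP hpath (S \ D) hdegR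
    have hm' : HasMatching G (P + 1 + (a * (P + 1) + b * P + j)) univ := by
      have hX' := le_card_sdiff {x, y} X
      have hF : #({x, y} : Finset V) ≤ 2 := card_le_two
      have h1 := hasMatching_of_complete (T := T) (Z := X \ {x, y})
        (fun t ht z hz => hTX t ht z (mem_sdiff.1 hz).1) (by omega)
      rw [hT] at h1
      have h2 : HasMatching G 1 {x, y} := ⟨x, by simp, y, by simp, hxy, trivial⟩
      refine ((h1.union h2 ?_).union hm ?_).mono (subset_univ _)
      · rw [disjoint_union_left]
        refine ⟨?_, sdiff_disjoint⟩
        simp [hxT, hyT]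
      · rw [disjoint_union_left, disjoint_union_left]
        refine ⟨⟨?_, Finset.disjoint_left.2 fun v hv hvR => ?_⟩, ?_⟩
        · exact disjoint_sdiff.mono_left (by rw [hD]; intro v hv; simp [hv])
        · rw [mem_sdiff] at hvR hv
          exact hsep v hvR.1 hvR.2 t₀ (by simp [hD, ht₀]) (hTX t₀ ht₀ v hv.1).symm
        · exact disjoint_sdiff.mono_left (by rw [hD]; intro v hv; simp at hv ⊢; tauto)
    have hle : a * (P + 1) + b * P + j + 1 ≤ c * (P + 1) + d := by
      by_contra hcon
      exact hmatch (hm'.of_le (by omega))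
    have hbound := hsys.bound_edge hM hd a b j hj hle
    have hsplit := cliqueCount_union_le (G := G) (k + 2) (D := D) (R := S \ D)
      (fun t ht v hv hvD hadj => hsep v (mem_sdiff.1 hv).1 hvD t ht hadj.symm)
    rw [union_sdiff_of_subset hDS] at hsplit
    have hchoose := cliqueCount_le_choose (G := G) (k + 2) D
    have hcard := card_sdiff_add_card_eq_card hDS
    rw [hDcard] at hchoose hcard
    have hg : gain P k (P + 2) = ((P + 2).choose (k + 2) : ℤ) -
      (P + 2 : ℕ) * (P.choose (k + 1) : ℤ) := rfl
    have hg' : gain P k (P + 2) = gain P k P + P.choose k := by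
      rw [show P + 2 = P + 1 + 1 by ring, gain_succ, gain_succ, Nat.choose_succ_succ' P]
      push_cast; ring
    have hcard' : (#S : ℤ) * (P.choose (k + 1) : ℤ) =
        #(S \ D) * (P.choose (k + 1) : ℤ) + (P + 2 : ℕ) * (P.choose (k + 1) : ℤ) := by
      rw [← hcard]; push_cast; ring
    zify at hsplit hchoose
    linarith

omit [Fintype V] in
lemma exists_cover {s : ℕ} : ∀ {S : Finset V}, ¬ HasMatching G (s + 1) S →
    ∃ U ⊆ S, #U ≤ 2 * s ∧ ∀ u ∈ S, ∀ v ∈ S, u ∉ U → v ∉ U → ¬ G.Adj u v := by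
  induction s with
  | zero =>
    intro S h
    exact ⟨∅, by simp, by simp, fun u hu v hv _ _ huv => h ⟨u, hu, v, hv, huv, trivial⟩⟩
  | succ s ih =>
    intro S h
    by_cases hS : ∃ u ∈ S, ∃ v ∈ S, G.Adj u v
    · obtain ⟨u, hu, v, hv, huv⟩ := hS
      obtain ⟨U, hU, hcard, hind⟩ := ih (S := (S.erase u).erase v)
        fun hm => h ⟨u, hu, v, hv, huv, hm⟩
      refine ⟨insert u (insert v U), ?_, ?_, ?_⟩
      · rw [insert_subset_iff, insert_subset_iff]
        exact ⟨hu, hv, hU.trans ((erase_subset _ _).trans (erase_subset _ _))⟩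
      · have h1 := card_insert_le u (insert v U)
        have h2 := card_insert_le v U
        omega
      · intro x hx y hy hxU hyU
        simp only [mem_insert, not_or] at hxU hyU
        exact hind x (by simp [hx, hxU]) y (by simp [hy, hyU]) hxU.2.2 hyU.2.2
    · push Not at hS
      exact ⟨∅, by simp, by simp, fun u hu v hv _ _ => hS u hu v hv⟩

omit [Fintype V] in
lemma cliqueCount_union_indep_le (r : ℕ) {U W : Finset V} (hUW : Disjoint U W)
    (hW : ∀ u ∈ W, ∀ v ∈ W, ¬ G.Adj u v) :
    cliqueCount G (r + 1) (U ∪ W) ≤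
      cliqueCount G (r + 1) U + ∑ w ∈ W, (#(nbrs G U w)).choose r := by
  induction W using Finset.induction_on with
  | empty => simp
  | insert w W hw ih =>
    rw [disjoint_insert_right] at hUW
    have h1 := ih hUW.2 fun u hu v hv => hW u (by simp [hu]) v (by simp [hv])
    have h2 := cliqueCount_insert_le (G := G) r (U ∪ W) (v := w) (by simp [hw, hUW.1])
    have h3 : nbrs G (U ∪ W) w = nbrs G U w := by
      ext x
      simp only [mem_nbrs, mem_union]
      constructor
      · rintro ⟨hx | hx, hadj⟩
        · exact ⟨hx, hadj⟩
        · exact absurd hadj (hW w (by simp) x (by simp [hx]))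
      · rintro ⟨hx, hadj⟩
        exact ⟨Or.inl hx, hadj⟩
    rw [sum_insert hw, union_insert]
    rw [h3] at h2
    omega

/-- Without a `P`-set having many common neighbours there are few cliques. -/
lemma cliqueCount_le_of_no_core {P s B : ℕ} (k : ℕ) (hP : 1 ≤ P)
    (hmatch : ¬ HasMatching G (s + 1) univ)
    (hT : ∀ T X : Finset V, #T = P → (∀ t ∈ T, ∀ x ∈ X, G.Adj t x) → #X ≤ B) :
    cliqueCount G (k + 2) univ ≤ (2 * s).choose (k + 2) +
      (2 * s).choose P * B * (2 * s).choose (k + 1) + Fintype.card V * (P - 1).choose (k + 1) := by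
  classical
  obtain ⟨U, -, hU, hind⟩ := exists_cover hmatch
  have h1 := cliqueCount_union_indep_le (G := G) (k + 1) (U := U) (W := univ \ U) disjoint_sdiff
    fun u hu v hv => hind u (by simp) v (by simp) (mem_sdiff.1 hu).2 (mem_sdiff.1 hv).2
  rw [union_sdiff_of_subset (subset_univ U), show k + 1 + 1 = k + 2 from rfl] at h1
  have h2 := (cliqueCount_le_choose (G := G) (k + 2) U).trans (Nat.choose_le_choose _ hU)
  set big : Finset V := {v | P ≤ #(nbrs G U v)} with hbig
  have h3 : #big ≤ (2 * s).choose P * B := by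
    have hsub : big ⊆ (U.powersetCard P).biUnion fun T => {v | ∀ t ∈ T, G.Adj t v} := by
      intro v hv
      rw [hbig, mem_filter] at hv
      obtain ⟨T, hTsub, hTcard⟩ := exists_subset_card_eq hv.2
      rw [mem_biUnion]
      refine ⟨T, mem_powersetCard.2 ⟨hTsub.trans (nbrs_subset _ _), hTcard⟩, ?_⟩
      simp only [mem_filter, mem_univ, true_and]
      exact fun t ht => (mem_nbrs.1 (hTsub ht)).2.symm
    have hcommon (T : Finset V) (hT' : #T = P) : #{v | ∀ t ∈ T, G.Adj t v} ≤ B :=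
      hT T _ hT' fun t ht x hx => by simpa using (mem_filter.1 hx).2 t ht
    refine (card_le_card hsub).trans ((card_biUnion_le_card_mul _ _ B fun T hT' =>
      hcommon T (mem_powersetCard.1 hT').2).trans ?_)
    rw [card_powersetCard]
    exact Nat.mul_le_mul_right _ (Nat.choose_le_choose _ hU)
  have h4 : ∑ w ∈ univ \ U, (#(nbrs G U w)).choose (k + 1) ≤
      ∑ w : V, ((if w ∈ big then (2 * s).choose (k + 1) else 0) + (P - 1).choose (k + 1)) := by
    refine (sum_le_sum_of_subset (subset_univ _)).trans (sum_le_sum fun w _ => ?_)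
    split_ifs with hw
    · exact (Nat.choose_le_choose _ ((card_le_card (nbrs_subset _ _)).trans hU)).trans
        (Nat.le_add_right _ _)
    · rw [zero_add]
      apply Nat.choose_le_choose
      simp only [hbig, mem_filter, mem_univ, true_and] at hw
      omega
  rw [sum_add_distrib, sum_ite_mem, univ_inter, sum_const, sum_const, card_univ, smul_eq_mul,
    smul_eq_mul] at h4
  have h5 := Nat.mul_le_mul_right ((2 * s).choose (k + 1)) h3
  omega

end UpperBound

end BoundedMatching

namespace BoundedMatching

open SimpleGraph Finset

section CopyCount

variable {V W : Type*}

lemma copyCount_eq_cliqueCount [DecidableEq V] [Fintype V] (G : SimpleGraph V) (r : ℕ) :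
    G.copyCount (K r) = cliqueCount G r univ := by
  classical
  rw [copyCount, cliqueCount]
  have hadj {G' : G.Subgraph} (e : K r ≃g G'.coe) {a b : V} (ha : a ∈ G'.verts)
      (hb : b ∈ G'.verts) (hab : a ≠ b) : G'.Adj a b := by
    have h : (K r).Adj (e.symm ⟨a, ha⟩) (e.symm ⟨b, hb⟩) := by
      rw [top_adj, Ne, e.symm.injective.eq_iff, Subtype.mk.injEq]
      exact hab
    exact e.symm.map_adj_iff.1 h
  refine card_bij (fun G' _ => G'.verts.toFinset) ?_ ?_ ?_
  · intro G' hG'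
    simp only [mem_filter, mem_univ, true_and] at hG'
    obtain ⟨e⟩ := hG'
    simp only [mem_filter, mem_powersetCard, subset_univ, true_and]
    refine ⟨?_, fun a ha b hb hab => ?_⟩
    · rw [Set.toFinset_card, ← Fintype.card_congr e.toEquiv, Fintype.card_fin]
    · simp only [Set.coe_toFinset] at ha hb
      exact (hadj e ha hb hab).adj_sub
  · intro G₁ h₁ G₂ h₂ h
    simp only [mem_filter, mem_univ, true_and] at h₁ h₂
    obtain ⟨e₁⟩ := h₁
    obtain ⟨e₂⟩ := h₂
    have hv : G₁.verts = G₂.verts := Set.toFinset_inj.1 h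
    refine Subgraph.ext hv ?_
    ext a b
    constructor
    · intro hab
      exact hadj e₂ (hv ▸ hab.fst_mem) (hv ▸ hab.snd_mem) hab.ne
    · intro hab
      exact hadj e₁ (hv ▸ hab.fst_mem) (hv ▸ hab.snd_mem) hab.ne
  · intro t ht
    simp only [mem_filter, mem_powersetCard, subset_univ, true_and] at ht
    refine ⟨(⊤ : G.Subgraph).induce t, ?_, by simp⟩
    simp only [mem_filter, mem_univ, true_and]
    have hcard : Fintype.card (((⊤ : G.Subgraph).induce (t : Set V)).verts) = r := by
      simp [ht.1]
    let e : Fin r ≃ ((⊤ : G.Subgraph).induce (t : Set V)).verts :=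
      Fintype.equivOfCardEq (by rw [hcard, Fintype.card_fin])
    refine ⟨⟨e, ?_⟩⟩
    intro a b
    rw [Subgraph.coe_adj, Subgraph.induce_adj, top_adj]
    constructor
    · rintro ⟨-, -, h⟩ rfl
      exact h.ne rfl
    · intro hab
      refine ⟨(e a).2, (e b).2, ht.2 (e a).2 (e b).2 fun h => hab (e.injective (Subtype.ext h))⟩

variable [DecidableEq V] [DecidableEq W] {G : SimpleGraph V} {H : SimpleGraph W}

lemma cliqueCount_le_map (f : G ↪g H) (r : ℕ) (S : Finset V) :
    cliqueCount G r S ≤ cliqueCount H r (S.map f.toEmbedding) := by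
  classical
  unfold cliqueCount
  refine card_le_card_of_injOn (fun t => t.map f.toEmbedding) ?_ ?_
  · intro t ht
    simp only [coe_filter, mem_powersetCard, Set.mem_ofPred_eq] at ht ⊢
    refine ⟨⟨map_subset_map.2 ht.1.1, by rw [card_map, ht.1.2]⟩, ?_⟩
    rintro a ha b hb hab
    simp only [coe_map, Set.mem_image] at ha hb
    obtain ⟨a, ha, rfl⟩ := ha
    obtain ⟨b, hb, rfl⟩ := hb
    exact f.map_adj_iff.2 (ht.2 ha hb fun h => hab (by rw [h]))
  · intro t _ t' _ h
    exact map_injective _ h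

lemma cliqueCount_mono (r : ℕ) {S S' : Finset V} (h : S ⊆ S') :
    cliqueCount G r S ≤ cliqueCount G r S' := by
  classical
  exact card_le_card (filter_subset_filter _ (powersetCard_mono h))

lemma cliqueCount_add_le (r : ℕ) {S S' : Finset V} (h : Disjoint S S') :
    cliqueCount G (r + 1) S + cliqueCount G (r + 1) S' ≤ cliqueCount G (r + 1) (S ∪ S') := by
  classical
  unfold cliqueCount
  rw [← card_union_of_disjoint]
  · refine card_le_card (union_subset ?_ ?_) <;>
      refine filter_subset_filter _ (powersetCard_mono ?_)
    exacts [subset_union_left, subset_union_right]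
  · rw [Finset.disjoint_left]
    intro t ht ht'
    simp only [mem_filter, mem_powersetCard] at ht ht'
    obtain ⟨x, hx⟩ : t.Nonempty := card_pos.1 (by omega)
    exact Finset.disjoint_left.1 h (ht.1.1 hx) (ht'.1.1 hx)

lemma choose_le_cliqueCount (r : ℕ) {S : Finset V} (hS : G.IsClique (S : Set V)) :
    (#S).choose r ≤ cliqueCount G r S := by
  classical
  rw [← card_powersetCard]
  refine card_le_card fun t ht => ?_
  rw [mem_filter]
  exact ⟨ht, hS.subset (by exact_mod_cast (mem_powersetCard.1 ht).1)⟩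

lemma cliqueCount_insert_ge (r : ℕ) {T S : Finset V} {v : V} (hv : v ∉ S) (hTS : T ⊆ S)
    (hT : G.IsClique (T : Set V)) (hvT : ∀ t ∈ T, G.Adj v t) :
    cliqueCount G (r + 1) S + (#T).choose r ≤ cliqueCount G (r + 1) (insert v S) := by
  classical
  unfold cliqueCount
  rw [powersetCard_succ_insert hv, filter_union, card_union_of_disjoint]
  · refine Nat.add_le_add_left ?_ _
    rw [← card_powersetCard, filter_image]
    refine card_le_card_of_injOn (fun t => insert v t) ?_ ?_
    · intro t ht
      simp only [mem_coe, mem_powersetCard] at ht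
      simp only [coe_image, coe_filter, mem_powersetCard]
      refine ⟨t, ⟨⟨ht.1.trans hTS, ht.2⟩, ?_⟩, rfl⟩
      rw [coe_insert]
      exact (hT.subset (by exact_mod_cast ht.1)).insert fun b hb _ => hvT b (ht.1 hb)
    · intro t ht t' ht' h
      simp only [mem_coe, mem_powersetCard] at ht ht'
      have h1 : v ∉ t := fun h => hv (hTS (ht.1 h))
      have h2 : v ∉ t' := fun h => hv (hTS (ht'.1 h))
      rw [← erase_insert h1, ← erase_insert h2]
      exact congrArg (fun s => s.erase v) h
  · rw [Finset.disjoint_left]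
    intro t ht ht'
    simp only [mem_filter, mem_powersetCard, mem_image] at ht ht'
    obtain ⟨⟨u, -, rfl⟩, -⟩ := ht'
    exact hv (ht.1.1 (mem_insert_self _ _))

lemma cliqueCount_union_ge (r : ℕ) {T S W : Finset V} (hSW : Disjoint S W) (hTS : T ⊆ S)
    (hT : G.IsClique (T : Set V)) (hTW : ∀ w ∈ W, ∀ t ∈ T, G.Adj w t) :
    cliqueCount G (r + 1) S + #W * (#T).choose r ≤ cliqueCount G (r + 1) (S ∪ W) := by
  induction W using Finset.induction_on with
  | empty => simp
  | insert w W hw ih =>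
    rw [disjoint_insert_right] at hSW
    have h1 := ih hSW.2 fun v hv => hTW v (by simp [hv])
    have h2 := cliqueCount_insert_ge (G := G) r (v := w) (S := S ∪ W) (by simp [hw, hSW.1])
      (hTS.trans subset_union_left) hT (hTW w (by simp))
    rw [card_insert_of_notMem hw, union_insert, Nat.add_mul]
    omega

variable [Fintype V] [Fintype W]

lemma cliqueCount_sum_ge (r : ℕ) : cliqueCount G (r + 1) univ + cliqueCount H (r + 1) univ ≤
    cliqueCount (G ⊕g H) (r + 1) univ := by
  refine (Nat.add_le_add (cliqueCount_le_map Embedding.sumInl _ _)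
    (cliqueCount_le_map Embedding.sumInr _ _)).trans ((cliqueCount_add_le r ?_).trans
      (cliqueCount_mono _ (subset_univ _)))
  rw [Finset.disjoint_left]
  intro x hx hx'
  simp only [mem_map] at hx hx'
  obtain ⟨a, -, rfl⟩ := hx
  obtain ⟨b, -, hb⟩ := hx'
  cases hb

lemma cliqueCount_copies_ge (r q : ℕ) : q * cliqueCount H (r + 1) univ ≤
    cliqueCount (copies q H) (r + 1) univ := by
  have key : ∀ I : Finset (Fin q), #I * cliqueCount H (r + 1) univ ≤
      cliqueCount (copies q H) (r + 1) (I ×ˢ univ) := by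
    intro I
    induction I using Finset.induction_on with
    | empty => simp
    | insert i I hi ih =>
      let f : H ↪g copies q H :=
        ⟨⟨fun w => (i, w), fun _ _ h => (Prod.mk.inj h).2⟩,
          ⟨fun h => h.2, fun h => ⟨rfl, h⟩⟩⟩
      have h1 := cliqueCount_le_map f (r + 1) univ
      have h2 := cliqueCount_add_le (G := copies q H) r
        (S := univ.map f.toEmbedding) (S' := I ×ˢ univ) (by
          rw [Finset.disjoint_left]
          rintro ⟨j, w⟩ hx hx'
          simp only [mem_map] at hx
          obtain ⟨a, -, ha⟩ := hx
          obtain rfl : i = j := congrArg Prod.fst ha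
          simp [hi] at hx')
      have h3 : univ.map f.toEmbedding ∪ I ×ˢ univ ⊆ (insert i I) ×ˢ (univ : Finset W) := by
        rintro ⟨j, w⟩ hx
        simp only [mem_union, mem_map, mem_product, mem_univ, and_true, true_and] at hx
        rcases hx with ⟨a, ha⟩ | hx
        · obtain rfl : i = j := congrArg Prod.fst ha
          simp
        · simp [hx]
      have h4 := cliqueCount_mono (G := copies q H) (r + 1) h3
      rw [card_insert_of_notMem hi, Nat.add_mul]
      omega
  have := key univ
  rwa [card_univ, Fintype.card_fin, univ_product_univ] at this

lemma choose_le_cliqueCount_complete (r m : ℕ) : m.choose r ≤ cliqueCount (K m) r univ := by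
  simpa using choose_le_cliqueCount (G := K m) r (S := univ) (IsClique.top _)

lemma cliqueCount_join_indep_ge (r a m : ℕ) : a.choose (r + 1) + m * a.choose r ≤
    cliqueCount (join (K a) (I m)) (r + 1) univ := by
  let T : Finset (Fin a ⊕ Fin m) := univ.map Function.Embedding.inl
  have hT : (join (K a) (I m)).IsClique (T : Set (Fin a ⊕ Fin m)) := by
    rintro x hx y hy hxy
    simp only [T, coe_map, Set.mem_image] at hx hy
    obtain ⟨x, -, rfl⟩ := hx
    obtain ⟨y, -, rfl⟩ := hy
    exact fun h => hxy (by rw [h])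
  have h1 := choose_le_cliqueCount (r + 1) hT
  have h2 := cliqueCount_union_ge r (S := T) (W := univ.map Function.Embedding.inr) (by
      rw [Finset.disjoint_left]; rintro (x | x) hx hx' <;> simp [T] at hx hx') Subset.rfl hT (by
      rintro (w | w) hw (t | t) ht <;> simp [T] at hw ht; trivial)
  have h3 := cliqueCount_mono (G := join (K a) (I m)) (r + 1)
    (subset_univ (T ∪ univ.map Function.Embedding.inr))
  simp only [T, card_map, card_univ, Fintype.card_fin] at h1 h2 h3
  omega

lemma cliqueCount_join_edge_ge (r a m : ℕ) : (a + 2).choose (r + 1) + m * a.choose r ≤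
    cliqueCount (join (K a) (K 2 ⊕g I m)) (r + 1) univ := by
  let T : Finset (Fin a ⊕ (Fin 2 ⊕ Fin m)) := univ.map Function.Embedding.inl
  let X : Finset (Fin a ⊕ (Fin 2 ⊕ Fin m)) :=
    univ.map (Function.Embedding.inl.trans Function.Embedding.inr)
  let Y : Finset (Fin a ⊕ (Fin 2 ⊕ Fin m)) :=
    univ.map (Function.Embedding.inr.trans Function.Embedding.inr)
  have hTX : Disjoint T X := by
    rw [Finset.disjoint_left]; rintro (x | x | x) hx hx' <;> simp [T, X] at hx hx'
  have hS : (join (K a) (K 2 ⊕g I m)).IsClique ((T ∪ X : Finset _) : Set _) := by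
    rintro (x | x | x) hx (y | y | y) hy hxy <;> simp [T, X] at hx hy hxy
    · exact hxy
    · trivial
    · trivial
    · exact hxy
  have h1 := choose_le_cliqueCount (r + 1) hS
  have h2 := cliqueCount_union_ge r (T := T) (S := T ∪ X) (W := Y) (by
      rw [Finset.disjoint_left]; rintro (x | x | x) hx hx' <;> simp [T, X, Y] at hx hx')
      subset_union_left (hS.subset (by simp)) (by
      rintro (w | w | w) hw (t | t | t) ht <;> simp [T, Y] at hw ht; trivial)
  have h3 := cliqueCount_mono (G := join (K a) (K 2 ⊕g I m)) (r + 1) (subset_univ (T ∪ X ∪ Y))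
  rw [card_union_of_disjoint hTX] at h1
  simp only [T, X, Y, card_map, card_univ, Fintype.card_fin] at h1 h2 h3
  omega

end CopyCount

section Free

/-- Every matching of `G` has at most `k` edges. -/
def MatchingLE {V : Type*} (G : SimpleGraph V) (k : ℕ) : Prop :=
  ∀ (ι : Type) [Fintype ι] (x y : ι → V), (∀ i, G.Adj (x i) (y i)) →
    Function.Injective (Sum.elim x y) → Fintype.card ι ≤ k

variable {V W : Type*} {G : SimpleGraph V} {H : SimpleGraph W} {a b k m : ℕ}

lemma MatchingLE.free (h : MatchingLE G k) : (matching (k + 1)).Free G := by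
  rintro ⟨f⟩
  have := h (Fin (k + 1)) (fun i => f (i, 0)) (fun i => f (i, 1))
    (fun i => f.toHom.map_adj ⟨rfl, by simp⟩) (Function.Injective.sumElim
      (fun i j hij => congrArg Prod.fst (f.injective hij))
      (fun i j hij => congrArg Prod.fst (f.injective hij))
      (fun i j hij => by simpa using congrArg Prod.snd (f.injective hij)))
  simp at this

lemma MatchingLE.mono (h : MatchingLE G a) (hab : a ≤ b) : MatchingLE G b :=
  fun ι _ x y hadj hinj => (h ι x y hadj hinj).trans hab

lemma injective_sumElim_of_lift {ι ι' : Type*} {x y : ι → W} {u v : ι' → V} {g : ι' → ι}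
    {f : V → W} (hinj : Function.Injective (Sum.elim x y)) (hg : Function.Injective g)
    (hu : ∀ i, x (g i) = f (u i)) (hv : ∀ i, y (g i) = f (v i)) :
    Function.Injective (Sum.elim u v) := by
  apply Function.Injective.of_comp (f := f)
  have : f ∘ Sum.elim u v = Sum.elim x y ∘ Sum.map g g := by
    ext (i | i) <;> simp [hu, hv]
  rw [this]
  exact hinj.comp (hg.sumMap hg)

lemma card_eq_card_subtype_add {ι : Type} [Fintype ι] (p : ι → Prop) [DecidablePred p] :
    Fintype.card ι = Fintype.card {i // p i} + Fintype.card {i // ¬ p i} := by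
  rw [← Fintype.card_sum]
  exact Fintype.card_congr (Equiv.sumCompl p).symm

lemma MatchingLE.sum (hG : MatchingLE G a) (hH : MatchingLE H b) :
    MatchingLE (G ⊕g H) (a + b) := by
  intro ι _ x y hadj hinj
  rw [card_eq_card_subtype_add fun i => (x i).isLeft = true]
  refine Nat.add_le_add ?_ ?_
  · have h : ∀ i : {i // (x i).isLeft = true}, ∃ u v, x i = Sum.inl u ∧ y i = Sum.inl v ∧
        G.Adj u v := by
      rintro ⟨i, hi⟩
      have := hadj i
      cases hx : x i <;> cases hy : y i <;> simp_all
    choose u v hu hv huv using h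
    exact hG _ u v huv (injective_sumElim_of_lift hinj Subtype.val_injective hu hv)
  · have h : ∀ i : {i // ¬ (x i).isLeft = true}, ∃ u v, x i = Sum.inr u ∧ y i = Sum.inr v ∧
        H.Adj u v := by
      rintro ⟨i, hi⟩
      have := hadj i
      cases hx : x i <;> cases hy : y i <;> simp_all
    choose u v hu hv huv using h
    exact hH _ u v huv (injective_sumElim_of_lift hinj Subtype.val_injective hu hv)

lemma MatchingLE.copies (hH : MatchingLE H b) (q : ℕ) : MatchingLE (copies q H) (q * b) := by
  classical
  intro ι _ x y hadj hinj
  have h := card_le_mul_card_image_of_maps_to (s := (univ : Finset ι)) (t := (univ : Finset (Fin q)))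
    (f := fun i => (x i).1) (fun _ _ => mem_univ _) b (fun j _ => by
      rw [← Fintype.card_subtype]
      refine hH {i // (x i).1 = j} (fun i => (x i).2) (fun i => (y i).2) (fun i => (hadj i).2)
        (injective_sumElim_of_lift (f := fun w => (j, w)) hinj Subtype.val_injective
          (fun i => ?_) (fun i => ?_))
      · exact Prod.ext i.2 rfl
      · exact Prod.ext ((hadj i).1.symm.trans i.2) rfl)
  rwa [card_univ, card_univ, Fintype.card_fin, Nat.mul_comm] at h

lemma matchingLE_complete (m : ℕ) : MatchingLE (K m) (m / 2) := by
  intro ι _ x y _ hinj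
  have := Fintype.card_le_of_injective _ hinj
  rw [Fintype.card_sum, Fintype.card_fin] at this
  omega

lemma matchingLE_indep (m : ℕ) : MatchingLE (I m) 0 := by
  intro ι _ x y hadj _
  have : IsEmpty ι := ⟨fun i => hadj i⟩
  simp

lemma card_meets_left_le {ι : Type} [Fintype ι] {x y : ι → Fin a ⊕ W}
    (hinj : Function.Injective (Sum.elim x y)) :
    Fintype.card {i // (x i).isLeft = true ∨ (y i).isLeft = true} ≤ a := by
  have h : ∀ i : {i // (x i).isLeft = true ∨ (y i).isLeft = true},
      ∃ t, ∃ e : ι ⊕ ι, Sum.elim x y e = Sum.inl t ∧ Sum.elim id id e = i.1 := by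
    rintro ⟨i, hi | hi⟩
    · obtain ⟨t, ht⟩ := Sum.isLeft_iff.1 hi
      exact ⟨t, Sum.inl i, ht, rfl⟩
    · obtain ⟨t, ht⟩ := Sum.isLeft_iff.1 hi
      exact ⟨t, Sum.inr i, ht, rfl⟩
  choose t e ht he using h
  have htinj : Function.Injective t := by
    intro i j hij
    have : e i = e j := hinj (by rw [ht, ht, hij])
    exact Subtype.ext (by rw [← he, ← he, this])
  simpa using Fintype.card_le_of_injective _ htinj

lemma MatchingLE.join (hH : MatchingLE H b) (a : ℕ) : MatchingLE (join (K a) H) (a + b) := by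
  intro ι _ x y hadj hinj
  rw [card_eq_card_subtype_add fun i => (x i).isLeft = true ∨ (y i).isLeft = true]
  refine Nat.add_le_add (card_meets_left_le hinj) ?_
  have h : ∀ i : {i // ¬ ((x i).isLeft = true ∨ (y i).isLeft = true)}, ∃ u v,
      x i = Sum.inr u ∧ y i = Sum.inr v ∧ H.Adj u v := by
    rintro ⟨i, hi⟩
    have := hadj i
    cases hx : x i <;> cases hy : y i <;> simp_all
    simpa [BoundedMatching.join] using this
  choose u v hu hv huv using h
  exact hH _ u v huv (injective_sumElim_of_lift hinj Subtype.val_injective hu hv)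

lemma eq_of_preconnected {α : Type*} (hG : G.Preconnected) {φ : V → α}
    (hφ : ∀ u v, G.Adj u v → φ u = φ v) (u v : V) : φ u = φ v := by
  obtain ⟨w⟩ := hG u v
  induction w with
  | nil => rfl
  | cons h _ ih => exact (hφ _ _ h).trans ih

lemma pathGraph_free_sum (hm : 0 < m) (hG : (pathGraph m).Free G) (hH : (pathGraph m).Free H) :
    (pathGraph m).Free (G ⊕g H) := by
  rintro ⟨f⟩
  have hconst := eq_of_preconnected (pathGraph_preconnected m) (φ := fun v => (f v).isLeft) (by
    intro u v huv
    have := f.toHom.map_adj huv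
    simp only [Copy.toHom_apply] at this
    cases hu : f u <;> cases hv : f v <;> simp_all)
  by_cases h0 : (f ⟨0, hm⟩).isLeft
  · have h : ∀ i, ∃ u, f i = Sum.inl u := fun i => Sum.isLeft_iff.1 (by rw [hconst i ⟨0, hm⟩, h0])
    choose g hg using h
    refine hG ⟨⟨⟨g, fun {i j} hij => ?_⟩, fun i j hij => f.injective ?_⟩⟩
    · have := f.toHom.map_adj hij
      simpa [hg] using this
    · simpa [hg] using hij
  · have h : ∀ i, ∃ u, f i = Sum.inr u := fun i => Sum.isRight_iff.1 (by
      rw [← Sum.not_isLeft, hconst i ⟨0, hm⟩]; simpa using h0)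
    choose g hg using h
    refine hH ⟨⟨⟨g, fun {i j} hij => ?_⟩, fun i j hij => f.injective ?_⟩⟩
    · have := f.toHom.map_adj hij
      simpa [hg] using this
    · simpa [hg] using hij

lemma pathGraph_free_copies (hH : (pathGraph m).Free H) (q : ℕ) :
    (pathGraph m).Free (copies q H) := by
  rintro ⟨f⟩
  have hconst := eq_of_preconnected (pathGraph_preconnected m) (φ := fun v => (f v).1)
    fun u v huv => (f.toHom.map_adj huv).1
  refine hH ⟨⟨⟨fun i => (f i).2, fun {i j} hij => (f.toHom.map_adj hij).2⟩,
    fun i j hij => f.injective (Prod.ext (hconst i j) hij)⟩⟩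

lemma pathGraph_free_complete (h : a < m) : (pathGraph m).Free (K a) := by
  rintro ⟨f⟩
  have := Fintype.card_le_of_injective _ f.injective
  simp at this
  omega

/-- If `H` has at most one edge, then `K_a ∨ H` has no path on `2 a + 3` vertices. -/
lemma pathGraph_free_join (hH : ∀ u v u' v', H.Adj u v → H.Adj u' v' → u' = u ∨ u' = v) :
    (pathGraph (2 * a + 3)).Free (join (K a) H) := by
  rintro ⟨f⟩
  have key : ∀ g : Fin (a + 1) → Fin (2 * a + 2), (∀ i, (g i : ℕ) = 2 * i) ∨
      (∀ i, (g i : ℕ) = 2 * i + 1) → ∃ i u v, f (g i).castSucc = Sum.inr u ∧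
        f (g i).succ = Sum.inr v ∧ H.Adj u v := by
    intro g hg
    have hinj : Function.Injective
        (Sum.elim (fun i => f (g i).castSucc) (fun i => f (g i).succ)) := by
      refine Function.Injective.sumElim (fun i j hij => ?_) (fun i j hij => ?_)
        (fun i j hij => ?_)
      all_goals
        have h := congrArg Fin.val (f.injective hij)
        simp only [Fin.val_castSucc, Fin.val_succ] at h
      · ext; rcases hg with hg | hg <;> rw [hg, hg] at h <;> omega
      · ext; rcases hg with hg | hg <;> rw [hg, hg] at h <;> omega
      · rcases hg with hg | hg <;> rw [hg, hg] at h <;> omega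
    have hcard := card_meets_left_le hinj
    obtain ⟨i, hi⟩ : ∃ i, ¬ ((f (g i).castSucc).isLeft = true ∨ (f (g i).succ).isLeft = true) := by
      by_contra! hcon
      rw [Fintype.card_congr (Equiv.subtypeUnivEquiv hcon), Fintype.card_fin] at hcard
      omega
    have hadj : (BoundedMatching.join (K a) H).Adj (f (g i).castSucc) (f (g i).succ) :=
      f.toHom.map_adj (pathGraph_adj.2 (Or.inl rfl))
    refine ⟨i, ?_⟩
    cases hx : f (g i).castSucc <;> cases hy : f (g i).succ <;> simp_all
    simpa [BoundedMatching.join] using hadj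
  obtain ⟨i, u, v, hu, hv, huv⟩ := key (fun i => ⟨2 * i, by omega⟩) (Or.inl fun _ => rfl)
  obtain ⟨j, u', v', hu', hv', huv'⟩ := key (fun i => ⟨2 * i + 1, by omega⟩) (Or.inr fun _ => rfl)
  have hne : ∀ {x y : Fin (2 * a + 3)} {w : W}, f x = Sum.inr w → f y = Sum.inr w →
      (x : ℕ) = y := fun hx hy => congrArg Fin.val (f.injective (hx.trans hy.symm))
  have h1 : 2 * (j : ℕ) + 1 = 2 * i ∨ 2 * (j : ℕ) + 1 = 2 * i + 1 := by
    rcases hH u v u' v' huv huv' with rfl | rfl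
    · exact Or.inl (hne hu' hu)
    · exact Or.inr (hne hu' hv)
  have h2 : 2 * (j : ℕ) + 1 + 1 = 2 * i ∨ 2 * (j : ℕ) + 1 + 1 = 2 * i + 1 := by
    rcases hH u v v' u' huv huv'.symm with rfl | rfl
    · exact Or.inl (hne hv' hu)
    · exact Or.inr (hne hv' hv)
  omega

end Free

end BoundedMatching

namespace BoundedMatching

open SimpleGraph Finset

/-- The forbidden family `{P_m, M_k}`. -/
abbrev forbidden (m k : ℕ) : Set (Σ V : Type, SimpleGraph V) :=
  {⟨_, pathGraph m⟩, ⟨_, matching k⟩}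

section Constructions

lemma copyCount_le_ex {W : Type} [Fintype W] {G : SimpleGraph W} {n m k : ℕ} (r : ℕ)
    (hcard : Fintype.card W = n) (hpath : (pathGraph m).Free G) (hmatch : MatchingLE G k) :
    G.copyCount (K r) ≤ ex n (K r) (forbidden m (k + 1)) := by
  classical
  let e : W ≃ Fin n := Fintype.equivFinOfCardEq hcard
  let f : G ≃g G.map e.toEmbedding := Iso.map e G
  have h1 : G.copyCount (K r) ≤ (G.map e.toEmbedding).copyCount (K r) := by
    rw [copyCount_eq_cliqueCount, copyCount_eq_cliqueCount]
    exact (cliqueCount_le_map f.toEmbedding r univ).trans (cliqueCount_mono r (subset_univ _))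
  refine h1.trans (Finset.le_sup (f := fun G : SimpleGraph (Fin n) => G.copyCount (K r))
    (mem_filter.2 ⟨mem_univ _, ?_⟩))
  rintro F (rfl | rfl)
  · exact (free_congr_right f).1 hpath
  · exact (free_congr_right f).1 hmatch.free

lemma join_indep_at_most_one_edge (m : ℕ) : ∀ u v u' v', (I m).Adj u v → (I m).Adj u' v' →
    u' = u ∨ u' = v := fun _ _ _ _ h => h.elim

lemma join_edge_at_most_one_edge (m : ℕ) : ∀ u v u' v', (K 2 ⊕g I m).Adj u v →
    (K 2 ⊕g I m).Adj u' v' → u' = u ∨ u' = v := by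
  rintro (u | u) (v | v) (u' | u') (v' | v') h h' <;> simp at h h'
  simp only [Sum.inl.injEq]
  omega

variable {P k n s m₀ a m b m' e : ℕ}

lemma last_clique_bound (hn : P + m₀ + a * m + e = n) (hm : m ≤ 2 * P + 2)
    (he : e ≤ 2 * P + 2) (hs : P + a * (m / 2) + e / 2 ≤ s) :
    (n * (P.choose (k + 1) : ℤ) + gain P k P + (a * gain P k m + gain P k e) ≤
      (join (K P) (I m₀) ⊕g copies a (K m) ⊕g K e).copyCount (K (k + 2))) ∧
    (join (K P) (I m₀) ⊕g copies a (K m) ⊕g K e).copyCount (K (k + 2)) ≤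
      ex n (K (k + 2)) (forbidden (2 * P + 3) (s + 1)) := by
  constructor
  · rw [copyCount_eq_cliqueCount]
    have h1 := cliqueCount_join_indep_ge (k + 1) P m₀
    have h2 := Nat.mul_le_mul_left a (choose_le_cliqueCount_complete (k + 2) m)
    have h3 := cliqueCount_copies_ge (H := K m) (k + 1) a
    have h4 := choose_le_cliqueCount_complete (k + 2) e
    have h5 := cliqueCount_sum_ge (G := join (K P) (I m₀)) (H := copies a (K m)) (k + 1)
    have h6 := cliqueCount_sum_ge (G := join (K P) (I m₀) ⊕g copies a (K m)) (H := K e) (k + 1)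
    simp only [show k + 1 + 1 = k + 2 from rfl] at *
    simp only [gain]
    zify at *
    rw [← hn]
    linarith
  · refine copyCount_le_ex _ ?_ ?_ (MatchingLE.mono
      ((((matchingLE_indep m₀).join P).sum ((matchingLE_complete m).copies a)).sum
        (matchingLE_complete e)) (by omega))
    · simp only [Fintype.card_sum, Fintype.card_prod, Fintype.card_fin]
      exact hn
    · exact pathGraph_free_sum (by omega) (pathGraph_free_sum (by omega)
        (pathGraph_free_join (join_indep_at_most_one_edge m₀))
        (pathGraph_free_copies (pathGraph_free_complete (by omega)) a))
        (pathGraph_free_complete (by omega))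

lemma two_families_bound (hn : P + m₀ + a * m + b * m' = n) (hm : m ≤ 2 * P + 2)
    (hm' : m' ≤ 2 * P + 2) (hs : P + a * (m / 2) + b * (m' / 2) ≤ s) :
    (n * (P.choose (k + 1) : ℤ) + gain P k P + (a * gain P k m + b * gain P k m') ≤
      (join (K P) (I m₀) ⊕g copies a (K m) ⊕g copies b (K m')).copyCount (K (k + 2))) ∧
    (join (K P) (I m₀) ⊕g copies a (K m) ⊕g copies b (K m')).copyCount (K (k + 2)) ≤
      ex n (K (k + 2)) (forbidden (2 * P + 3) (s + 1)) := by
  constructor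
  · rw [copyCount_eq_cliqueCount]
    have h1 := cliqueCount_join_indep_ge (k + 1) P m₀
    have h2 := Nat.mul_le_mul_left a (choose_le_cliqueCount_complete (k + 2) m)
    have h3 := cliqueCount_copies_ge (H := K m) (k + 1) a
    have h4 := Nat.mul_le_mul_left b (choose_le_cliqueCount_complete (k + 2) m')
    have h4' := cliqueCount_copies_ge (H := K m') (k + 1) b
    have h5 := cliqueCount_sum_ge (G := join (K P) (I m₀)) (H := copies a (K m)) (k + 1)
    have h6 := cliqueCount_sum_ge (G := join (K P) (I m₀) ⊕g copies a (K m))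
      (H := copies b (K m')) (k + 1)
    simp only [show k + 1 + 1 = k + 2 from rfl] at *
    simp only [gain]
    zify at *
    rw [← hn]
    linarith
  · refine copyCount_le_ex _ ?_ ?_ (MatchingLE.mono
      ((((matchingLE_indep m₀).join P).sum ((matchingLE_complete m).copies a)).sum
        ((matchingLE_complete m').copies b)) (by omega))
    · simp only [Fintype.card_sum, Fintype.card_prod, Fintype.card_fin]
      exact hn
    · exact pathGraph_free_sum (by omega) (pathGraph_free_sum (by omega)
        (pathGraph_free_join (join_indep_at_most_one_edge m₀))
        (pathGraph_free_copies (pathGraph_free_complete (by omega)) a))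
        (pathGraph_free_copies (pathGraph_free_complete (by omega)) b)

lemma extra_edge_bound (hn : P + (2 + m₀) + a * m = n) (hm : m ≤ 2 * P + 2)
    (hs : P + 1 + a * (m / 2) ≤ s) :
    (n * (P.choose (k + 1) : ℤ) + gain P k P + (a * gain P k m + P.choose k) ≤
      (join (K P) (K 2 ⊕g I m₀) ⊕g copies a (K m)).copyCount (K (k + 2))) ∧
    (join (K P) (K 2 ⊕g I m₀) ⊕g copies a (K m)).copyCount (K (k + 2)) ≤
      ex n (K (k + 2)) (forbidden (2 * P + 3) (s + 1)) := by
  constructor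
  · rw [copyCount_eq_cliqueCount]
    have h1 := cliqueCount_join_edge_ge (k + 1) P m₀
    have h2 := Nat.mul_le_mul_left a (choose_le_cliqueCount_complete (k + 2) m)
    have h3 := cliqueCount_copies_ge (H := K m) (k + 1) a
    have h5 := cliqueCount_sum_ge (G := join (K P) (K 2 ⊕g I m₀)) (H := copies a (K m)) (k + 1)
    have h6 : (P + 2).choose (k + 2) = P.choose (k + 2) + 2 * P.choose (k + 1) + P.choose k := by
      rw [Nat.choose_succ_succ' (P + 1), Nat.choose_succ_succ' P, Nat.choose_succ_succ' P]
      ring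
    simp only [show k + 1 + 1 = k + 2 from rfl] at *
    rw [h6] at h1
    simp only [gain]
    zify at *
    rw [← hn]
    linarith
  · refine copyCount_le_ex _ ?_ ?_ (MatchingLE.mono
      (((((matchingLE_complete 2).sum (matchingLE_indep m₀)).join P).sum
        ((matchingLE_complete m).copies a))) (by omega))
    · simp only [Fintype.card_sum, Fintype.card_prod, Fintype.card_fin]
      exact hn
    · exact pathGraph_free_sum (by omega)
        (pathGraph_free_join (join_edge_at_most_one_edge m₀))
        (pathGraph_free_copies (pathGraph_free_complete (by omega)) a)

end Constructions

/-- The upper bound: any number dominating the values of the constructions bounds the Turán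
number once `n` is large. -/
lemma ex_le {P k c d : ℕ} (hP : 1 ≤ P) (hk : k + 1 ≤ P) (hd : d ≤ P) :
    ∃ n₀ : ℕ, ∀ n ≥ n₀, ∀ N : ℕ,
      Dominates P c d (gain P k (2 * P + 2)) (P.choose k) (fun j => gain P k (lastOrder j))
        (N - n * (P.choose (k + 1) : ℤ) - gain P k P) →
      ex n (K (k + 2)) (forbidden (2 * P + 3) (P + (c * (P + 1) + d) + 1)) ≤ N := by
  classical
  set s := P + (c * (P + 1) + d) with hs
  set K₀ := (2 * s).choose (k + 2) + (2 * s).choose P * (P + 4) * (2 * s).choose (k + 1) with hK₀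
  refine ⟨((K₀ : ℤ) - gain P k P - (c * gain P k (2 * P + 2) + gain P k (lastOrder d))).toNat,
    fun n hn N hN => ?_⟩
  refine Finset.sup_le fun G hG => ?_
  rw [mem_filter] at hG
  have hfree := hG.2
  have hpath : ∀ l : List (Fin n), l.IsChain G.Adj → l.Nodup → l.length ≤ 2 * P + 2 := by
    intro l hl hl'
    by_contra hcon
    exact hfree _ (Or.inl rfl)
      (pathGraph_isContained_of_isChain hl hl' (show 2 * P + 3 ≤ l.length by omega))
  have hmatch : ¬ HasMatching G (s + 1) univ := fun h => hfree _ (Or.inr rfl) h.isContained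
  rw [copyCount_eq_cliqueCount]
  by_cases hcore : ∀ T X : Finset (Fin n), #T = P → (∀ t ∈ T, ∀ x ∈ X, G.Adj t x) → #X ≤ P + 4
  · have h1 := cliqueCount_le_of_no_core k hP hmatch hcore
    have h2 : (P - 1).choose (k + 1) + 1 ≤ P.choose (k + 1) := by
      obtain ⟨P, rfl⟩ : ∃ P', P = P' + 1 := ⟨P - 1, by omega⟩
      rw [Nat.choose_succ_succ' P, Nat.add_sub_cancel]
      have := Nat.choose_pos (show k ≤ P by omega)
      omega
    have h3 := Nat.mul_le_mul_left n h2
    have h4 := hN.four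
    have h5 := Int.self_le_toNat
      ((K₀ : ℤ) - gain P k P - (c * gain P k (2 * P + 2) + gain P k (lastOrder d)))
    rw [Fintype.card_fin] at h1
    zify at *
    linarith
  · push Not at hcore
    obtain ⟨T, X, hT, hTX, hX⟩ := hcore
    have h := cliqueCount_le_of_core (G := G) hP hT hX.le hTX hpath hmatch hd hN
    rw [Fintype.card_fin] at h
    zify
    linarith

lemma ex_eq_zero {r m k n : ℕ} (h : m ≤ r) : ex n (K r) (forbidden m k) = 0 := by
  classical
  refine Nat.le_zero.1 (Finset.sup_le fun G hG => ?_)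
  rw [mem_filter] at hG
  refine (copyCount_eq_zero.2 fun hK => hG.2 _ (Or.inl rfl) (IsContained.trans ?_ hK)).le
  exact ⟨⟨⟨Fin.castLE h, fun hadj => by
    rw [top_adj, Ne, (Fin.castLE_injective h).eq_iff]; exact hadj.ne⟩, Fin.castLE_injective h⟩⟩

end BoundedMatching

open BoundedMatching SimpleGraph in
theorem theorem1p8 (r p s c d : ℕ) (hr : 2 ≤ r) (hp : 2 ≤ p) (hps : p ≤ s)
    (hrp : r ≤ p ∨ 2 * p < r)
    (hcd : s - p + 1 = c * p + d) (hd : d ≤ p - 1) :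
    ∀ᶠ n : ℕ in Filter.atTop,
      let exn := ex n (K r) {⟨_, pathGraph (2 * p + 1)⟩, ⟨_, matching (s + 1)⟩}
      let N₃ := (G₃ n s p).copyCount (K r)
      let N₄ := (G₄ n p c d).copyCount (K r)
      let N₅ := (G₅ n p c d).copyCount (K r)
      let N₆ := (G₆ n p c).copyCount (K r)
      (d = 0 → exn = max N₃ N₄) ∧
      (1 ≤ d ∧ d ≤ p - 2 →
        (p ≤ c + d + 1 → exn = max (max N₃ N₄) (max N₅ N₆)) ∧
        (c + d + 1 < p → exn = max (max N₃ N₄) N₆)) ∧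
      (d = p - 1 → exn = max (max N₃ N₄) N₆) := by
  obtain ⟨k, rfl⟩ : ∃ k, r = k + 2 := ⟨r - 2, by omega⟩
  obtain ⟨P, rfl⟩ : ∃ P, p = P + 1 := ⟨p - 1, by omega⟩
  have hP : 1 ≤ P := by omega
  have hdP : d ≤ P := by omega
  have hs : s = P + (c * (P + 1) + d) := by omega
  have hlast (t : ℕ) : lastOrder t ≤ 2 * t + 1 := by unfold lastOrder; split_ifs <;> omega
  have hlastP : lastOrder P = 2 * P + 1 := by simp [lastOrder]; omega
  -- the parameters of `G₃`
  have hq : (s - (P + 1) + 1) / (P + 1 - 1) = (c * (P + 1) + d) / P := by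
    rw [hcd, Nat.add_sub_cancel]
  have ht : s - ((s - (P + 1) + 1) / (P + 1 - 1) + 1) * (P + 1 - 1) = (c * (P + 1) + d) % P := by
    have := Nat.div_add_mod (c * (P + 1) + d) P
    rw [hq, Nat.add_sub_cancel, Nat.add_mul, Nat.mul_comm, hs]
    omega
  have htP : (c * (P + 1) + d) % P < P := Nat.mod_lt _ hP
  have hqt := Nat.div_add_mod (c * (P + 1) + d) P
  set q := (c * (P + 1) + d) / P with hqdef
  set t := (c * (P + 1) + d) % P with htdef
  have hlow : ∀ᶠ n : ℕ in Filter.atTop,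
      ((n * (P.choose (k + 1) : ℤ) + gain P k P + (q * gain P k (lastOrder P) +
          gain P k (lastOrder t)) ≤ (G₃ n s (P + 1)).copyCount (K (k + 2))) ∧
        (G₃ n s (P + 1)).copyCount (K (k + 2)) ≤
          ex n (K (k + 2)) (forbidden (2 * P + 3) (s + 1))) ∧
      ((n * (P.choose (k + 1) : ℤ) + gain P k P + (c * gain P k (2 * P + 2) +
          gain P k (lastOrder d)) ≤ (G₄ n (P + 1) c d).copyCount (K (k + 2))) ∧
        (G₄ n (P + 1) c d).copyCount (K (k + 2)) ≤
          ex n (K (k + 2)) (forbidden (2 * P + 3) (s + 1))) ∧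
      (P ≤ c + d → (n * (P.choose (k + 1) : ℤ) + gain P k P +
          ((c + d - P : ℕ) * gain P k (2 * P + 2) +
            (P + 1 - d : ℕ) * gain P k (lastOrder P)) ≤
              (G₅ n (P + 1) c d).copyCount (K (k + 2))) ∧
        (G₅ n (P + 1) c d).copyCount (K (k + 2)) ≤
          ex n (K (k + 2)) (forbidden (2 * P + 3) (s + 1))) ∧
      (1 ≤ d → (n * (P.choose (k + 1) : ℤ) + gain P k P + (c * gain P k (2 * P + 2) +
          P.choose k) ≤ (G₆ n (P + 1) c).copyCount (K (k + 2))) ∧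
        (G₆ n (P + 1) c).copyCount (K (k + 2)) ≤
          ex n (K (k + 2)) (forbidden (2 * P + 3) (s + 1))) := by
    filter_upwards [Filter.eventually_ge_atTop (P + q * (2 * P + 1) + lastOrder t),
      Filter.eventually_ge_atTop (P + c * (2 * P + 2) + lastOrder d),
      Filter.eventually_ge_atTop (P + (c + d - P) * (2 * P + 2) + (P + 1 - d) * (2 * P + 1)),
      Filter.eventually_ge_atTop (P + 2 + c * (2 * P + 2))] with n h3 h4 h5 h6
    refine ⟨?_, ?_, fun h => ?_, fun h => ?_⟩
    · have hl := hlast t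
      have key := last_clique_bound (P := P) (k := k) (n := n) (s := s)
        (m₀ := n - (P + q * (2 * P + 1) + lastOrder t)) (a := q) (m := 2 * P + 1)
        (e := lastOrder t) (by omega) (by omega) (by omega) (by
          rw [show (2 * P + 1) / 2 = P by omega, Nat.mul_comm q P]; omega)
      rw [hlastP]
      unfold G₃
      dsimp only
      rw [ht, hq]
      exact key
    · have hl := hlast d
      exact last_clique_bound (P := P) (k := k) (n := n) (s := s)
        (m₀ := n - (P + c * (2 * P + 2) + lastOrder d)) (a := c) (m := 2 * P + 2)
        (e := lastOrder d) (by omega) (by omega) (by omega) (by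
          rw [show (2 * P + 2) / 2 = P + 1 by omega]; omega)
    · have key := two_families_bound (P := P) (k := k) (n := n) (s := s)
        (m₀ := n - (P + (c + d - P) * (2 * P + 2) + (P + 1 - d) * (2 * P + 1)))
        (a := c + d - P) (m := 2 * P + 2) (b := P + 1 - d) (m' := 2 * P + 1) (by omega) (by omega)
        (by omega) (by
          rw [show (2 * P + 2) / 2 = P + 1 by omega, show (2 * P + 1) / 2 = P by omega, hs]
          obtain ⟨u, hu⟩ := Nat.exists_eq_add_of_le h
          obtain ⟨v, hv⟩ := Nat.exists_eq_add_of_le hdP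
          rw [show c + d - P = u by omega, show P + 1 - d = v + 1 by omega]
          have hc : c = u + v := by omega
          subst hc
          subst hv
          apply le_of_eq
          ring)
      rw [hlastP]
      unfold G₅
      rw [show c + d + 1 - (P + 1) = c + d - P by omega]
      exact key
    · exact extra_edge_bound (P := P) (k := k) (n := n) (s := s)
        (m₀ := n - (P + 2 + c * (2 * P + 2))) (a := c) (m := 2 * P + 2) (by omega) (by omega) (by
          rw [show (2 * P + 2) / 2 = P + 1 by omega]; omega)
  obtain ⟨n₀, hn₀⟩ : ∃ n₀ : ℕ, ∀ n ≥ n₀, ∀ N : ℕ,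
      Dominates P c d (gain P k (2 * P + 2)) (P.choose k) (fun j => gain P k (lastOrder j))
        (N - n * (P.choose (k + 1) : ℤ) - gain P k P) →
      ex n (K (k + 2)) (forbidden (2 * P + 3) (s + 1)) ≤ N := by
    rcases hrp with hrp | hrp
    · rw [hs]
      exact ex_le hP (by omega) hdP
    · exact ⟨0, fun n _ N _ => by rw [ex_eq_zero (by omega)]; exact Nat.zero_le _⟩
  filter_upwards [hlow, Filter.eventually_ge_atTop n₀] with n hn hnn
  dsimp only
  obtain ⟨⟨l3, u3⟩, ⟨l4, u4⟩, h5, h6⟩ := hn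
  have hup := hn₀ n hnn
  rw [show 2 * (P + 1) + 1 = 2 * P + 3 by ring]
  change (d = 0 → ex n (K (k + 2)) (forbidden (2 * P + 3) (s + 1)) = _) ∧ _
  generalize (G₃ n s (P + 1)).copyCount (K (k + 2)) = N₃ at *
  generalize (G₄ n (P + 1) c d).copyCount (K (k + 2)) = N₄ at *
  generalize (G₅ n (P + 1) c d).copyCount (K (k + 2)) = N₅ at *
  generalize (G₆ n (P + 1) c).copyCount (K (k + 2)) = N₆ at *
  have hmain : ∀ N : ℕ, N₃ ≤ N → N₄ ≤ N → (1 ≤ d → d + 1 ≤ P → P ≤ c + d → N₅ ≤ N) →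
      (1 ≤ d → N₆ ≤ N) → ex n (K (k + 2)) (forbidden (2 * P + 3) (s + 1)) ≤ N := by
    intro N b3 b4 b5 b6
    apply hup
    zify at b3 b4
    refine ⟨?_, ?_, fun g1 g2 g3 => ?_, fun g1 => ?_⟩
    · linarith
    · linarith
    · have := (h5 g3).1
      have hb : (N₅ : ℤ) ≤ N := by exact_mod_cast b5 g1 g2 g3
      linarith
    · have := (h6 g1).1
      have hb : (N₆ : ℤ) ≤ N := by exact_mod_cast b6 g1
      linarith
  refine ⟨fun hd0 => le_antisymm (hmain _ (by simp) (by simp) (by omega) (by omega))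
    (max_le u3 u4), fun hd1 => ⟨fun hc => le_antisymm
      (hmain _ (by simp) (by simp) (by simp) (by simp))
      (max_le (max_le u3 u4) (max_le (h5 (by omega)).2 (h6 hd1.1).2)), fun hc => le_antisymm
      (hmain _ (by simp) (by simp) (by omega) (by simp))
      (max_le (max_le u3 u4) (h6 hd1.1).2)⟩, fun hdp => le_antisymm
      (hmain _ (by simp) (by simp) (by omega) (by simp)) (max_le (max_le u3 u4) (h6 (by omega)).2)⟩
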